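/- **Setting.** Let $\mathcal T_h$ be a geometrically conforming triangular mesh of a bounded connected polygonal domain $\Omega\subset\mathbb R^2$; every boundary face is either a solid wall or identified by a translation with another boundary face (periodicity). For $T\in\mathcal T_h$ let $|T|$ be its area, $\mathfrak p_T$ its perimeter, $\mathcal F_T$ its faces and $\vec n_{TF}$ the outward unit normals; $\mathbb P^k(\mathcal T_h)$ is the space of broken polynomials of degree at most $k$. Let $g,\alpha,\varepsilon_0>0$, $h_0\in\mathbb R$, let $b$ be a Lipschitz bottom on $\overline\Omega$, $b_h$ its $L^2$ projection on $\mathbb P^k(\mathcal T_h)$, and $h_b=\max(h_0-b,\varepsilon_0)$. Discrete states are $W_h=(\eta_h,q_h)\in\mathbb P^k(\mathcal T_h)\times\mathbb P^k(\mathcal T_h)^2$, with $h_h=\eta_h-b_h$. Write $$\mathbb F(W,b)=\begin{pmatrix}{}^tq\\ \frac{q\otimes q}{\eta-b}+\frac g2(\eta^2-2\eta b)I_2\end{pmatrix},\qquad \mathbb B(W,b)=\begin{pmatrix}0\\-g\eta\nabla b\end{pmatrix}.$$ *Interface flux.* With interior and exterior traces $W^\mp,b^\mp$ on a face $F$ of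 $T$ (at a wall the exterior state is the mirror state $\eta^+=\eta^-$, $b^+=b^-$, $q^+=q^--2(q^-\cdot\vec n)\vec n$), put $b^*=\max(b^-,b^+)$, $\check b=b^*-\max(0,b^*-\eta^-)$, $\check h^\pm=\max(0,\eta^\pm-b^*)$, $\check\eta^\pm=\check h^\pm+\check b$, $\check W^\pm=\big(\check\eta^\pm,\tfrac{\check h^\pm}{\eta^\pm-b^\pm}q^\pm\big)$ (quotients with zero denominator are read as $0$) and $$\widehat{\mathbb F}_{TF}=\tfrac12\big(\mathbb F(\check W^-,\check b)\vec n_{TF}+\mathbb F(\check W^+,\check b)\vec n_{TF}-a(\check W^+-\check W^-)\big)+\begin{pmatrix}0\\ g\check\eta^-(\check b-b^-)\vec n_{TF}\end{pmatrix},$$ where $a=\max_T\lambda_T$ and $\lambda_T=\sup_{\partial T}\big(|\tfrac{q_h}{\eta_h-b_h}\cdot\vec n_T|+\sqrt{g(\eta_h-b_h)}\big)$. *Dispersive source.* $\mathbb D(W_h,b_h)=(0,\mathcal D_{c,h})$, where, with $\mathbb T[h_b]w=-\frac13\nabla\cdot(h_b^3\nabla\frac w{h_b})$, $\mathcal D_{c,h}$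 is obtained from $$[1+\alpha\mathbb T[h_b]]\mathcal K=gh\nabla\eta,\qquad [1+\alpha\mathbb T[h_b]]\big(\mathcal D_c+\tfrac1\alpha gh\nabla\eta\big)=\tfrac1\alpha gh\nabla\eta+h\big(\mathcal Q_1[h,b](v)+g\mathcal Q_2[h,b](\eta)\big)+\mathcal Q_3[h,h_b]\mathcal K,$$ $v=q/h$. Here, with $\mathcal R_1w=-\frac1{3h}\nabla(h^3w)-\frac h2w\nabla b$, $\mathcal R_2w=\frac1{2h}\nabla(h^2w)+w\nabla b$ and ${}^\perp(x_1,x_2)=(-x_2,x_1)$, $$\mathcal Q_1(v)=-2\mathcal R_1\big(\partial_1v\cdot\partial_2v^\perp+(\nabla\cdot v)^2\big)+\mathcal R_2\big(v\cdot(v\cdot\nabla)\nabla b\big),$$ $$\mathcal Q_2(\eta)=-h(\nabla^\perp h\cdot\nabla)\nabla^\perp\eta-\tfrac1{2h}\nabla(h^2\nabla b\cdot\nabla\eta)+\big(\tfrac h2\Delta\eta-\nabla b\cdot\nabla\eta\big)\nabla b,$$ $$\mathcal Q_3w=\tfrac16\nabla(h^2-h_b^2)\cdot\nabla w+\tfrac13(h^2-h_b^2)\Delta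 w-\tfrac16\Delta(h^2-h_b^2)\,w .$$ Both problems, in each vector component, are discretized in the mixed form $w-\alpha\nabla\cdot(\frac13h_b^2p-\frac16w\nabla h_b^2)=f$, $p=\nabla w$, by the local discontinuous Galerkin (LDG) method in $\mathbb P^k(\mathcal T_h)$, with $h_b^2,\nabla h_b^2$ replaced by their $L^2$ projections and fluxes $\hat w=\{w\}+(\beta\cdot\vec n)[w]$, $\hat p=\{p\}-\beta([p]\cdot\vec n)+\frac\xi{|F|}[w]\vec n$, where $\{w\}=\frac12(w^++w^-)$, $[w]=w^+-w^-$, and $\xi\in\mathbb R$, $\beta\in\mathbb R^2$ are constants (exterior traces at walls are mirror images). The right-hand sides are computed by products at unisolvent interpolation nodes of $\mathbb P^k(T)$ in $\overline T$, with all derivatives of $\eta_h$, $b_h$, $h_h$, of the nodal interpolants and of $\mathcal K_h$ replaced by their LDG derivatives with the same fluxes. *Scheme.* One forward Euler step of length $\Delta t>0$ from $W_h^n$ to $W_h^{n+1}$ means that for all $T\in\mathcal T_h$ and $\phi\in\mathbb P^k(T)$ $$\int_T\frac{W_h^{n+1}-W_h^n}{\Delta t}\phi-\int_T\mathbb F(W_h^n,b_h)\cdot\nabla\phi+\sum_{F\in\mathcal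 F_T}\int_F\widehat{\mathbb F}_{TF}\phi+\int_T\mathbb D(W_h^n,b_h)\phi=\int_T\mathbb B(W_h^n,b_h)\phi ,$$ where the integrals, except the first, may be computed exactly or by quadrature rules. **Proposition.** 1. (Well-balancing.) Assume that the discrete LDG operator of $1+\alpha\mathbb T[h_b]$ is invertible and that the integrals of the scheme are computed exactly at the state $\eta_h^n\equiv\eta^e$, $q_h^n\equiv0$, with $\eta^e\in\mathbb R$ constant. At this state $\mathbb D(W_h^n,b_h)=0$, and the Euler step from this state exists, is unique, and gives $\eta_h^{n+1}\equiv\eta^e$, $q_h^{n+1}\equiv0$. (No assumption is made on the sign of $\eta^e-b_h$.) 2. (Positivity.) Let the face integrals be computed by the $(k+1)$-point Gauss rule, let $\beta$ be the smallest integer with $2\beta-3\ge k$, let $\hat\omega_1^\beta$ be the first weight of the $\beta$-point Gauss–Lobatto rule on the unit interval, and let $S_T^k$ be the image of the tensor product of the $\beta$-point Gauss–Lobatto nodes $u$ and the $(k+1)$-point Gauss nodes $v$ in $[0,1]$ under the three maps $(u,v)\mapsto vV_i+(1-v)(uV_{i+1}+(1-u)V_{i+2})$, $i\in\mathbb Z/3$,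 where $V_1,V_2,V_3$ are the vertices of $T$. Suppose that all $\lambda_T$ are finite at $W_h^n$, that the mean value of $h_h^n$ on every $T$ is nonnegative, that $h^n_{h|T}\ge0$ on $S_T^k$ for every $T$, and that, with $a=\max_{T'}\lambda_{T'}$, $$a\,\frac{\mathfrak p_T}{|T|}\,\Delta t\le\tfrac23\,\hat\omega_1^\beta\qquad\text{for all }T\in\mathcal T_h .$$ Then the mean value of $h_h^{n+1}=\eta_h^{n+1}-b_h$ on every $T\in\mathcal T_h$ is nonnegative. -/

import Mathlib

open MeasureTheory Set

noncomputable section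

namespace GreenNaghdi

/-- The horizontal plane `ℝ²` with its Euclidean structure and Lebesgue measure. -/
abbrev Plane : Type := EuclideanSpace ℝ (Fin 2)

/-! ### Triangular meshes -/

/-- Rotation by a right angle. -/
def rot (x : Plane) : Plane := !₂[x 1, -x 0]

/-- The `i`-th face of the triangle `V 0, V 1, V 2` is the edge opposite to the vertex `V i`. -/
def triFace (V : Fin 3 → Plane) (i : Fin 3) : Set Plane := segment ℝ (V (i + 1)) (V (i + 2))

/-- Unit normal to the `i`-th face, pointing out of the triangle. -/
def triNormal (V : Fin 3 → Plane) (i : Fin 3) : Plane :=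
  if inner ℝ (rot (V (i + 2) - V (i + 1))) (V i - V (i + 1)) < 0 then
    ‖V (i + 2) - V (i + 1)‖⁻¹ • rot (V (i + 2) - V (i + 1))
  else
    -(‖V (i + 2) - V (i + 1)‖⁻¹ • rot (V (i + 2) - V (i + 1)))

/-- The translation that moves the midpoint of face `i` of `V` to the midpoint of face `j`
of `V'`. It vanishes when the two faces coincide. -/
def triShift (V V' : Fin 3 → Plane) (i j : Fin 3) : Plane :=
  midpoint ℝ (V' (j + 1)) (V' (j + 2)) - midpoint ℝ (V (i + 1)) (V (i + 2))

/-- A geometrically conforming triangular mesh of a bounded connected open set, together with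
the type of each boundary face: a boundary face is either a solid wall (`glue = none`) or
identified by a translation with another boundary face (periodicity). For an interface,
`glue` returns the element on the other side. -/
structure TriMesh where
  /-- the domain -/
  Ω : Set Plane
  isOpen_Ω : IsOpen Ω
  isBounded_Ω : Bornology.IsBounded Ω
  isConnected_Ω : IsConnected Ω
  /-- the number of elements -/
  card : ℕ
  /-- the vertices of each element -/
  vert : Fin card → Fin 3 → Plane
  nondegenerate : ∀ T, AffineIndependent ℝ (vert T)
  cover : closure Ω = ⋃ T, convexHull ℝ (range (vert T))
  disjoint : ∀ T T', T ≠ T' →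
    Disjoint (interior (convexHull ℝ (range (vert T)))) (interior (convexHull ℝ (range (vert T'))))
  conforming : ∀ T T', T ≠ T' →
    convexHull ℝ (range (vert T)) ∩ convexHull ℝ (range (vert T')) =
      convexHull ℝ (range (vert T) ∩ range (vert T'))
  /-- the element (and its face) on the other side of a face; `none` for a solid wall -/
  glue : Fin card → Fin 3 → Option (Fin card × Fin 3)
  glue_interface : ∀ T T' i j, T ≠ T' → triFace (vert T) i = triFace (vert T') j →
    glue T i = some (T', j)
  glue_symm : ∀ T T' i j, glue T i = some (T', j) → glue T' j = some (T, i)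
  glue_face : ∀ T T' i j, glue T i = some (T', j) →
    (fun x => x + triShift (vert T) (vert T') i j) '' triFace (vert T) i = triFace (vert T') j
  glue_normal : ∀ T T' i j, glue T i = some (T', j) →
    triNormal (vert T') j = -triNormal (vert T) i

namespace TriMesh

/-- The elements of the mesh. -/
abbrev Elt (M : TriMesh) : Type := Fin M.card

/-- The open triangle. -/
def cell (M : TriMesh) (T : M.Elt) : Set Plane := interior (convexHull ℝ (range (M.vert T)))

/-- `|T|` -/
def area (M : TriMesh) (T : M.Elt) : ℝ := (volume (M.cell T)).toReal

/-- `|F|` -/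
def len (M : TriMesh) (T : M.Elt) (i : Fin 3) : ℝ := dist (M.vert T (i + 1)) (M.vert T (i + 2))

/-- `𝔭_T` -/
def perimeter (M : TriMesh) (T : M.Elt) : ℝ := ∑ i, M.len T i

/-- `n_{TF}` -/
def normal (M : TriMesh) (T : M.Elt) (i : Fin 3) : Plane := triNormal (M.vert T) i

/-- Parametrization of a face by `t ∈ [0, 1]`. -/
def pt (M : TriMesh) (T : M.Elt) (i : Fin 3) (t : ℝ) : Plane :=
  AffineMap.lineMap (M.vert T (i + 1)) (M.vert T (i + 2)) t

/-- `∫_T f dx` -/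
def volInt (M : TriMesh) (T : M.Elt) (f : Plane → ℝ) : ℝ := ∫ x in M.cell T, f x

/-- `∫_F f ds`, where `f` is given as a function of the parameter of the face. -/
def faceInt (M : TriMesh) (T : M.Elt) (i : Fin 3) (f : ℝ → ℝ) : ℝ :=
  M.len T i * ∫ t in (0 : ℝ)..1, f t

end TriMesh

/-! ### Broken polynomials and their traces -/

/-- Bivariate polynomials of total degree at most `k`. -/
abbrev Pk (k : ℕ) : Type := MvPolynomial.restrictTotalDegree (Fin 2) ℝ k

/-- Value of a polynomial at a point. -/
def ev (p : MvPolynomial (Fin 2) ℝ) (x : Plane) : ℝ := MvPolynomial.eval (fun i => x i) p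

/-- Value of the `j`-th partial derivative of a polynomial at a point. -/
def evD (j : Fin 2) (p : MvPolynomial (Fin 2) ℝ) (x : Plane) : ℝ := ev (MvPolynomial.pderiv j p) x

/-- The broken polynomial space `ℙ^k(𝒯_h)`. -/
abbrev Field (M : TriMesh) (k : ℕ) : Type := M.Elt → Pk k

/-- `ℝ²`-valued broken polynomials. -/
abbrev VField (M : TriMesh) (k : ℕ) : Type := Fin 2 → Field M k

/-- Discrete states `W_h = (η_h, q_h)`, i.e. the space `X_h`. -/
abbrev State (M : TriMesh) (k : ℕ) : Type := Fin 3 → Field M k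

variable {M : TriMesh} {k : ℕ}

/-- Interior trace on a face. -/
def tr (u : Field M k) (T : M.Elt) (i : Fin 3) (t : ℝ) : ℝ := ev (u T) (M.pt T i t)

/-- Exterior trace of a scalar field; a scalar is mirrored evenly at a wall. -/
def ext (u : Field M k) (T : M.Elt) (i : Fin 3) (t : ℝ) : ℝ :=
  match M.glue T i with
  | none => tr u T i t
  | some (T', j) => ev (u T') (M.pt T i t + triShift (M.vert T) (M.vert T') i j)

/-- The reflection `1 - 2 n ⊗ n`. -/
def reflMat (n : Plane) (c l : Fin 2) : ℝ := (if c = l then 1 else 0) - 2 * n c * n l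

/-- Exterior trace of a vector field: `V - 2 (V · n) n` at a wall. -/
def extV (V : VField M k) (T : M.Elt) (i : Fin 3) (t : ℝ) (c : Fin 2) : ℝ :=
  match M.glue T i with
  | none => ∑ l, reflMat (M.normal T i) c l * tr (V l) T i t
  | some _ => ext (V c) T i t

/-- Exterior trace of the gradient `P c j = ∂_j V_c` of a vector field: mirror image at a wall. -/
def extT (P : Fin 2 → VField M k) (T : M.Elt) (i : Fin 3) (t : ℝ) (c j : Fin 2) : ℝ :=
  match M.glue T i with
  | none => ∑ l, ∑ m, reflMat (M.normal T i) c l * tr (P l m) T i t * reflMat (M.normal T i) m j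
  | some _ => ext (P c j) T i t

/-- The polynomial of degree at most `k` that represents a linear functional on `ℙ^k(T)` in the
`L²(T)` inner product (it is unique). -/
def riesz (M : TriMesh) {k : ℕ} (T : M.Elt) (ℓ : Pk k → ℝ) : Pk k :=
  Classical.epsilon fun p : Pk k => ∀ φ : Pk k, M.volInt T (fun x => ev p x * ev φ x) = ℓ φ

/-- `L²` projection on the broken polynomial space. -/
def l2proj (M : TriMesh) (k : ℕ) (f : Plane → ℝ) : Field M k :=
  fun T => riesz M T fun φ => M.volInt T fun x => f x * ev φ x

/-- Mean value on an element. -/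
def mean (u : Field M k) (T : M.Elt) : ℝ := (M.area T)⁻¹ * M.volInt T (ev (u T))

/-! ### Parameters and topography -/

/-- Gravity `g`, model parameter `α`, reference depth `h₀`, dry threshold `ε₀`, and the
penalization and upwinding parameters `ξ`, `β` of the LDG fluxes. -/
structure Params where
  g : ℝ
  α : ℝ
  h₀ : ℝ
  ε₀ : ℝ
  ξ : ℝ
  β : Plane
  g_pos : 0 < g
  α_pos : 0 < α
  ε₀_pos : 0 < ε₀

/-- Modified water depth at rest `h_b = max(h₀ - b, ε₀)`. -/
def restDepth (P : Params) (b : Plane → ℝ) (x : Plane) : ℝ := max (P.h₀ - b x) P.ε₀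

/-- `L²` projection of `h_b²`. -/
def Hb (M : TriMesh) (k : ℕ) (P : Params) (b : Plane → ℝ) : Field M k :=
  l2proj M k fun x => restDepth P b x ^ 2

/-- `L²` projection of `∇ h_b²`. -/
def gradHb (M : TriMesh) (k : ℕ) (P : Params) (b : Plane → ℝ) : VField M k :=
  fun j => l2proj M k fun x =>
    fderiv ℝ (fun y => restDepth P b y ^ 2) x (EuclideanSpace.single j (1 : ℝ))

/-! ### LDG fluxes, discrete derivatives and the discrete elliptic problem -/

/-- `ŵ = {w} + (β · n) [w]` with `{w} = (w⁺ + w⁻)/2`, `[w] = w⁺ - w⁻`. -/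
def wHat (P : Params) (n : Plane) (wm wp : ℝ) : ℝ :=
  (wp + wm) / 2 + (∑ l, P.β l * n l) * (wp - wm)

/-- `p̂ = {p} - β ([p] · n) + (ξ/|F|) [w] n` -/
def pHat (P : Params) (n : Plane) (len : ℝ) (wm wp : ℝ) (pm pp : Fin 2 → ℝ) (j : Fin 2) : ℝ :=
  (pp j + pm j) / 2 - P.β j * (∑ l, (pp l - pm l) * n l) + P.ξ / len * (wp - wm) * n j

/-- Discrete first derivatives of `u`, whose exterior traces are `up`:
`∫_T p_j φ + ∫_T u ∂_jφ - ∑_F ∫_F û n_j φ = 0`. -/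
def ldgGrad (P : Params) (u : Field M k) (up : M.Elt → Fin 3 → ℝ → ℝ) : VField M k :=
  fun j T => riesz M T fun φ =>
    -M.volInt T (fun x => ev (u T) x * evD j φ x)
      + ∑ i, M.faceInt T i (fun t =>
          wHat P (M.normal T i) (tr u T i t) (up T i t) * M.normal T i j * ev φ (M.pt T i t))

/-- Discrete second derivatives `∂_l ∂_j u` from the discrete gradient `p` of `u`:
`∫_T s_{jl} φ + ∫_T p_j ∂_lφ - ∑_F ∫_F p̂_j n_l φ = 0`. -/
def ldgHess (P : Params) (u : Field M k) (up : M.Elt → Fin 3 → ℝ → ℝ)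
    (p : VField M k) (pp : M.Elt → Fin 3 → ℝ → Fin 2 → ℝ) : Fin 2 → Fin 2 → Field M k :=
  fun j l T => riesz M T fun φ =>
    -M.volInt T (fun x => ev (p j T) x * evD l φ x)
      + ∑ i, M.faceInt T i (fun t =>
          pHat P (M.normal T i) (M.len T i) (tr u T i t) (up T i t)
            (fun m => tr (p m) T i t) (pp T i t) j * M.normal T i l * ev φ (M.pt T i t))

/-- Discrete gradient of a scalar field. -/
def grad (P : Params) (u : Field M k) : VField M k := ldgGrad P u (ext u)

/-- Discrete Hessian of a scalar field. -/
def hess (P : Params) (u : Field M k) : Fin 2 → Fin 2 → Field M k :=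
  ldgHess P u (ext u) (grad P u) (extV (grad P u))

/-- Discrete gradient of a vector field, `gradV P V c j ≈ ∂_j V_c`. -/
def gradV (P : Params) (V : VField M k) : Fin 2 → VField M k :=
  fun c => ldgGrad P (V c) (fun T i t => extV V T i t c)

/-- Discrete second derivatives of a vector field, `hessV P V c j l ≈ ∂_l ∂_j V_c`. -/
def hessV (P : Params) (V : VField M k) : Fin 2 → Fin 2 → Fin 2 → Field M k :=
  fun c => ldgHess P (V c) (fun T i t => extV V T i t c) (gradV P V c)
    (fun T i t j => extT (gradV P V) T i t c j)

/-- `(w, p)` solves the LDG discretization, with source `f`, of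
`w - α ∇·(H p / 3 - w ∇H / 6) = f`, `p = ∇w`, where `H = h_b²`. The unknown is `ℝ²`-valued and
the problem is posed for each of its components `w c`, with `p c j ≈ ∂_j (w c)`. -/
def IsLDGSolution (P : Params) (b : Plane → ℝ) (w : VField M k) (p : Fin 2 → VField M k)
    (f : VField M k) : Prop :=
  (∀ (T : M.Elt) (c : Fin 2) (φ : Pk k),
    M.volInt T (fun x => ev (w c T) x * ev φ x)
      + P.α / 3 * M.volInt T (fun x =>
          ev (Hb M k P b T) x * ∑ j, ev (p c j T) x * evD j φ x)
      - P.α / 3 * ∑ i, M.faceInt T i (fun t =>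
          tr (Hb M k P b) T i t *
            (∑ j, pHat P (M.normal T i) (M.len T i) (tr (w c) T i t) (extV w T i t c)
                (fun m => tr (p c m) T i t) (fun m => extT p T i t c m) j * M.normal T i j)
            * ev φ (M.pt T i t))
      - P.α / 6 * M.volInt T (fun x =>
          ev (w c T) x * ∑ j, ev (gradHb M k P b j T) x * evD j φ x)
      + P.α / 6 * ∑ i, M.faceInt T i (fun t =>
          wHat P (M.normal T i) (tr (w c) T i t) (extV w T i t c)
            * (∑ j, tr (gradHb M k P b j) T i t * M.normal T i j) * ev φ (M.pt T i t))
      = M.volInt T (fun x => ev (f c T) x * ev φ x)) ∧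
  (∀ (T : M.Elt) (c j : Fin 2) (φ : Pk k),
    M.volInt T (fun x => ev (p c j T) x * ev φ x)
      + M.volInt T (fun x => ev (w c T) x * evD j φ x)
      - ∑ i, M.faceInt T i (fun t =>
          wHat P (M.normal T i) (tr (w c) T i t) (extV w T i t c) * M.normal T i j
            * ev φ (M.pt T i t)) = 0)

/-- The discrete operator `1 + α 𝕋[h_b]` can be inverted. -/
def LDGWellPosed (M : TriMesh) (k : ℕ) (P : Params) (b : Plane → ℝ) : Prop :=
  ∀ f : VField M k, ∃! wp : VField M k × (Fin 2 → VField M k), IsLDGSolution P b wp.1 wp.2 f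

/-! ### The dispersive source term, by nodal products -/

/-- A family of interpolation nodes for `ℙ^k(T)` in every closed element. -/
structure Nodes (M : TriMesh) (k : ℕ) where
  node : M.Elt → Fin ((k + 1) * (k + 2) / 2) → Plane
  node_mem : ∀ T i, node T i ∈ convexHull ℝ (range (M.vert T))
  unisolvent : ∀ T (y : Fin ((k + 1) * (k + 2) / 2) → ℝ),
    ∃! p : Pk k, ∀ i, ev p (node T i) = y i

/-- Nodal interpolation. -/
def interp (X : Nodes M k) (f : M.Elt → Plane → ℝ) : Field M k :=
  fun T => Classical.epsilon fun p : Pk k => ∀ i, ev p (X.node T i) = f T (X.node T i)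

/-- `R₁[h,b] w = -(1/(3h)) ∇(h³ w) - (h/2) w ∇b` -/
def R₁ (X : Nodes M k) (P : Params) (h b w : Field M k) : VField M k := fun c =>
  interp X fun T x =>
    -(1 / (3 * ev (h T) x)) *
        ev (grad P (interp X fun T x => ev (h T) x ^ 3 * ev (w T) x) c T) x
      - ev (h T) x / 2 * ev (w T) x * ev (grad P b c T) x

/-- `R₂[h,b] w = (1/(2h)) ∇(h² w) + w ∇b` -/
def R₂ (X : Nodes M k) (P : Params) (h b w : Field M k) : VField M k := fun c =>
  interp X fun T x =>
    1 / (2 * ev (h T) x) *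
        ev (grad P (interp X fun T x => ev (h T) x ^ 2 * ev (w T) x) c T) x
      + ev (w T) x * ev (grad P b c T) x

/-- `Q₁[h,b](v) = -2 R₁(∂₁v · ∂₂v^⊥ + (∇·v)²) + R₂(v · (v·∇)∇b)`, with `(v₁,v₂)^⊥ = (-v₂,v₁)`. -/
def Q₁ (X : Nodes M k) (P : Params) (h b : Field M k) (v : VField M k) : VField M k :=
  -(2 : ℝ) • R₁ X P h b (interp X fun T x =>
      -(ev (gradV P v 0 0 T) x * ev (gradV P v 1 1 T) x)
        + ev (gradV P v 1 0 T) x * ev (gradV P v 0 1 T) x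
        + (ev (gradV P v 0 0 T) x + ev (gradV P v 1 1 T) x) ^ 2)
  + R₂ X P h b (interp X fun T x =>
      ∑ c, ∑ j, ev (v c T) x * ev (v j T) x * ev (hess P b c j T) x)

/-- `((∇^⊥h · ∇) ∇^⊥ζ)`, with `∇^⊥ = (-∂₂, ∂₁)`, as a function of `∇h` and of the Hessian of `ζ`. -/
def perpTerm (dh : Fin 2 → ℝ) (H : Fin 2 → Fin 2 → ℝ) : Fin 2 → ℝ :=
  ![-(-dh 1 * H 1 0 + dh 0 * H 1 1), -dh 1 * H 0 0 + dh 0 * H 0 1]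

/-- `Q₂[h,b](ζ) = -h (∇^⊥h·∇)∇^⊥ζ - (1/(2h)) ∇(h² ∇b·∇ζ) + ((h/2) Δζ - ∇b·∇ζ) ∇b` -/
def Q₂ (X : Nodes M k) (P : Params) (h b ζ : Field M k) : VField M k := fun c =>
  interp X fun T x =>
    -ev (h T) x * perpTerm (fun j => ev (grad P h j T) x) (fun j l => ev (hess P ζ j l T) x) c
      - 1 / (2 * ev (h T) x) * ev (grad P (interp X fun T x =>
          ev (h T) x ^ 2 * ∑ j, ev (grad P b j T) x * ev (grad P ζ j T) x) c T) x
      + (ev (h T) x / 2 * ∑ j, ev (hess P ζ j j T) x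
          - ∑ j, ev (grad P b j T) x * ev (grad P ζ j T) x) * ev (grad P b c T) x

/-- `Q₃[h,h_b] K = ∇(h²-h_b²)·∇K / 6 + (h²-h_b²) ΔK / 3 - Δ(h²-h_b²) K / 6`, componentwise;
`m` is the interpolant of `h² - h_b²`. -/
def Q₃ (X : Nodes M k) (P : Params) (m : Field M k) (K : VField M k) : VField M k := fun c =>
  interp X fun T x =>
    1 / 6 * ∑ j, ev (grad P m j T) x * ev (gradV P K c j T) x
      + ev (m T) x / 3 * ∑ j, ev (hessV P K c j j T) x
      - 1 / 6 * (∑ j, ev (hess P m j j T) x) * ev (K c T) x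

/-- `g h ∇η` -/
def source₁ (X : Nodes M k) (P : Params) (h η : Field M k) : VField M k := fun c =>
  interp X fun T x => P.g * ev (h T) x * ev (grad P η c T) x

/-- `(1/α) g h ∇η + h (Q₁[h,b](v) + g Q₂[h,b](η)) + Q₃[h,h_b] K` -/
def source₂ (X : Nodes M k) (P : Params) (h b η m : Field M k) (v K : VField M k) : VField M k :=
  fun c => interp X fun T x =>
    1 / P.α * P.g * ev (h T) x * ev (grad P η c T) x
      + ev (h T) x * (ev (Q₁ X P h b v c T) x + P.g * ev (Q₂ X P h b η c T) x)
      + ev (Q₃ X P m K c T) x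

/-- `D = 𝔻(W_h, b_h)`: its first component vanishes and the two others form `𝒟_c`, where
`(1 + α𝕋) K = g h ∇η` and
`(1 + α𝕋)(𝒟_c + (1/α) g h ∇η) = (1/α) g h ∇η + h (Q₁(v) + g Q₂(η)) + Q₃ K`. -/
def IsDispersiveSource (X : Nodes M k) (P : Params) (b : Plane → ℝ) (W D : State M k) : Prop :=
  let bh : Field M k := l2proj M k b
  let η : Field M k := W 0
  let q : VField M k := ![W 1, W 2]
  let h : Field M k := η - bh
  let v : VField M k := fun c => interp X fun T x => ev (q c T) x / ev (h T) x
  let m : Field M k := interp X fun T x => ev (h T) x ^ 2 - restDepth P b x ^ 2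
  ∃ (K Z : VField M k) (pK pZ : Fin 2 → VField M k),
    IsLDGSolution P b K pK (source₁ X P h η) ∧
    IsLDGSolution P b Z pZ (source₂ X P h bh η m v K) ∧
    D 0 = 0 ∧
    D 1 = Z 0 - (1 / P.α) • source₁ X P h η 0 ∧
    D 2 = Z 1 - (1 / P.α) • source₁ X P h η 1

/-! ### The advective part: flux, topography source and interface flux -/

/-- The flux `𝔽(W, b)`: first row `q`, then `q ⊗ q / (η - b) + (g/2)(η² - 2 η b) I₂`. -/
def flux (P : Params) (W : Fin 3 → ℝ) (b : ℝ) : Fin 3 → Fin 2 → ℝ :=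
  ![![W 1, W 2],
    ![W 1 * W 1 / (W 0 - b) + P.g / 2 * (W 0 ^ 2 - 2 * W 0 * b), W 1 * W 2 / (W 0 - b)],
    ![W 2 * W 1 / (W 0 - b), W 2 * W 2 / (W 0 - b) + P.g / 2 * (W 0 ^ 2 - 2 * W 0 * b)]]

/-- The topography source `𝔹 = (0, -g η ∇b)`. -/
def topoSource (P : Params) (η : ℝ) (db : Fin 2 → ℝ) : Fin 3 → ℝ :=
  ![0, -P.g * η * db 0, -P.g * η * db 1]

/-- The global Lax–Friedrichs flux with speed `a`. -/
def laxFriedrichs (P : Params) (a : ℝ) (Wm Wp : Fin 3 → ℝ) (bm bp : ℝ) (n : Plane) (c : Fin 3) :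
    ℝ :=
  1 / 2 * (∑ j, flux P Wm bm c j * n j + ∑ j, flux P Wp bp c j * n j - a * (Wp c - Wm c))

/-- `ȟ = max(0, η - b*)` -/
def hCheck (η bs : ℝ) : ℝ := max 0 (η - bs)

/-- `b̌ = b* - max(0, b* - η⁻)` -/
def bCheck (ηm bs : ℝ) : ℝ := bs - max 0 (bs - ηm)

/-- `W̌ = (ȟ + b̌, (ȟ / (η - b)) q)` -/
def wCheck (W : Fin 3 → ℝ) (b bs bc : ℝ) : Fin 3 → ℝ :=
  ![hCheck (W 0) bs + bc, hCheck (W 0) bs / (W 0 - b) * W 1, hCheck (W 0) bs / (W 0 - b) * W 2]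

/-- The modified interface flux: hydrostatic reconstruction, Lax–Friedrichs flux and correction
`(0, g η̌⁻ (b̌ - b⁻) n)`. -/
def interfaceFlux (P : Params) (a : ℝ) (Wm Wp : Fin 3 → ℝ) (bm bp : ℝ) (n : Plane) (c : Fin 3) :
    ℝ :=
  let bs := max bm bp
  let bc := bCheck (Wm 0) bs
  let Wm' := wCheck Wm bm bs bc
  let Wp' := wCheck Wp bp bs bc
  laxFriedrichs P a Wm' Wp' bc bc n c
    + ![0, P.g * Wm' 0 * (bc - bm) * n 0, P.g * Wm' 0 * (bc - bm) * n 1] c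

/-- The values on `∂T` of `|q/(η - b) · n| + √(g (η - b))`. -/
def speedSet (P : Params) (bh : Field M k) (W : State M k) (T : M.Elt) : Set ℝ :=
  {s | ∃ i : Fin 3, ∃ t ∈ Icc (0 : ℝ) 1,
    s = |tr (W 1) T i t / (tr (W 0) T i t - tr bh T i t) * M.normal T i 0
          + tr (W 2) T i t / (tr (W 0) T i t - tr bh T i t) * M.normal T i 1|
        + √(P.g * (tr (W 0) T i t - tr bh T i t))}

/-- `λ_T` -/
def lam (P : Params) (bh : Field M k) (W : State M k) (T : M.Elt) : ℝ := sSup (speedSet P bh W T)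

/-- `a = max_T λ_T` -/
def maxSpeed (P : Params) (bh : Field M k) (W : State M k) : ℝ := ⨆ T, lam P bh W T

/-- Interior trace of a state. -/
def trW (W : State M k) (T : M.Elt) (i : Fin 3) (t : ℝ) : Fin 3 → ℝ := fun c => tr (W c) T i t

/-- Exterior trace of a state. -/
def extW (W : State M k) (T : M.Elt) (i : Fin 3) (t : ℝ) : Fin 3 → ℝ :=
  ![ext (W 0) T i t, extV ![W 1, W 2] T i t 0, extV ![W 1, W 2] T i t 1]

/-- `F̂_{TF}` along a face of `T`. -/
def numFlux (P : Params) (bh : Field M k) (W : State M k) (T : M.Elt) (i : Fin 3) (t : ℝ)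
    (c : Fin 3) : ℝ :=
  interfaceFlux P (maxSpeed P bh W) (trW W T i t) (extW W T i t) (tr bh T i t) (ext bh T i t)
    (M.normal T i) c

/-! ### Integration rules -/

/-- How the integrals over the elements are computed: exactly, or by a cubature rule. -/
inductive VolumeRule (M : TriMesh) : Type
  | exact : VolumeRule M
  | cubature (n : ℕ) (node : M.Elt → Fin n → Plane) (weight : M.Elt → Fin n → ℝ) : VolumeRule M

/-- Value of a volume integral according to a rule. -/
def VolumeRule.apply : VolumeRule M → M.Elt → (Plane → ℝ) → ℝ
  | .exact, T, f => M.volInt T f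
  | .cubature _ node weight, T, f => ∑ i, weight T i * f (node T i)

/-- How the integrals over the faces are computed: exactly, or by a quadrature rule on `[0,1]`. -/
inductive FaceRule : Type
  | exact : FaceRule
  | quadrature (n : ℕ) (node weight : Fin n → ℝ) : FaceRule

/-- Value of a face integral according to a rule. -/
def FaceRule.apply (M : TriMesh) : FaceRule → M.Elt → Fin 3 → (ℝ → ℝ) → ℝ
  | .exact, T, i, f => M.faceInt T i f
  | .quadrature _ node weight, T, i, f => M.len T i * ∑ r, weight r * f (node r)

/-- The `n`-point Gauss rule on `[0,1]`: exact up to degree `2n - 1`. -/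
structure IsGaussRule (n : ℕ) (x w : Fin n → ℝ) : Prop where
  strictMono : StrictMono x
  mem : ∀ i, x i ∈ Icc (0 : ℝ) 1
  exact : ∀ p : Polynomial ℝ, p.natDegree + 1 ≤ 2 * n →
    ∑ i, w i * p.eval (x i) = ∫ t in (0 : ℝ)..1, p.eval t

/-- The `n`-point Gauss–Lobatto rule on `[0,1]`: it uses both end points and is exact up to
degree `2n - 3`. -/
structure IsGaussLobattoRule (n : ℕ) (x w : Fin n → ℝ) : Prop where
  strictMono : StrictMono x
  first : ∀ i : Fin n, i.val = 0 → x i = 0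
  last : ∀ i : Fin n, i.val + 1 = n → x i = 1
  exact : ∀ p : Polynomial ℝ, p.natDegree + 3 ≤ 2 * n →
    ∑ i, w i * p.eval (x i) = ∫ t in (0 : ℝ)..1, p.eval t

/-- The smallest integer `β` such that `2β - 3 ≥ k`. -/
abbrev lobattoCount (k : ℕ) : ℕ := k / 2 + 2

theorem isLeast_lobattoCount (k : ℕ) : IsLeast {β : ℕ | k + 3 ≤ 2 * β} (lobattoCount k) := by
  constructor
  · show k + 3 ≤ 2 * (k / 2 + 2)
    omega
  · intro β hβ
    have h : k + 3 ≤ 2 * β := hβ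
    show k / 2 + 2 ≤ β
    omega

/-- The Zhang–Shu nodes `S_T^k`: images of the tensor product of the Gauss–Lobatto nodes `y` and
the Gauss nodes `x` under the three maps
`(u, v) ↦ v V_i + (1 - v)(u V_{i+1} + (1 - u) V_{i+2})` from the unit square to the triangle. -/
def zhangShuNodes (M : TriMesh) (k : ℕ) (y : Fin (lobattoCount k) → ℝ) (x : Fin (k + 1) → ℝ)
    (T : M.Elt) : Set Plane :=
  {z | ∃ (i : Fin 3) (s : Fin (lobattoCount k)) (r : Fin (k + 1)),
    z = x r • M.vert T i
      + (1 - x r) • (y s • M.vert T (i + 1) + (1 - y s) • M.vert T (i + 2))}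

/-! ### The fully discrete scheme -/

/-- `W'` is obtained from `W` by one forward Euler step of length `Δt` of the discontinuous
Galerkin scheme: for every element and test polynomial,
`∫_T (W' - W)/Δt φ - ∫_T 𝔽·∇φ + ∑_F ∫_F F̂_{TF} φ + ∫_T 𝔻 φ = ∫_T 𝔹 φ`. -/
def IsEulerStep (X : Nodes M k) (P : Params) (b : Plane → ℝ) (vr : VolumeRule M) (fr : FaceRule)
    (Δt : ℝ) (W W' : State M k) : Prop :=
  let bh : Field M k := l2proj M k b
  ∃ D : State M k, IsDispersiveSource X P b W D ∧
    ∀ (T : M.Elt) (c : Fin 3) (φ : Pk k),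
      M.volInt T (fun x => (ev (W' c T) x - ev (W c T) x) / Δt * ev φ x)
        - vr.apply T (fun x =>
            ∑ j, flux P (fun d => ev (W d T) x) (ev (bh T) x) c j * evD j φ x)
        + ∑ i, fr.apply M T i (fun t => numFlux P bh W T i t c * ev φ (M.pt T i t))
        + vr.apply T (fun x => ev (D c T) x * ev φ x)
      = vr.apply T (fun x =>
          topoSource P (ev (W 0 T) x) (fun j => evD j (bh T) x) c * ev φ x)

/-- The advective, topographic and interface integrals of the scheme are computed exactly at
the state `W`. -/
def ExactlyComputedAt (P : Params) (b : Plane → ℝ) (vr : VolumeRule M) (fr : FaceRule)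
    (W : State M k) : Prop :=
  let bh : Field M k := l2proj M k b
  ∀ (T : M.Elt) (c : Fin 3) (φ : Pk k),
    (vr.apply T (fun x => ∑ j, flux P (fun d => ev (W d T) x) (ev (bh T) x) c j * evD j φ x)
      = M.volInt T (fun x =>
          ∑ j, flux P (fun d => ev (W d T) x) (ev (bh T) x) c j * evD j φ x)) ∧
    (vr.apply T (fun x => topoSource P (ev (W 0 T) x) (fun j => evD j (bh T) x) c * ev φ x)
      = M.volInt T (fun x =>
          topoSource P (ev (W 0 T) x) (fun j => evD j (bh T) x) c * ev φ x)) ∧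
    (∀ i, fr.apply M T i (fun t => numFlux P bh W T i t c * ev φ (M.pt T i t))
      = M.faceInt T i (fun t => numFlux P bh W T i t c * ev φ (M.pt T i t)))

/-- `W` is the motionless steady state `η_h ≡ ηe`, `q_h ≡ 0`. -/
def IsAtRest (ηe : ℝ) (W : State M k) : Prop :=
  ∀ T, (W 0 T : MvPolynomial (Fin 2) ℝ) = MvPolynomial.C ηe ∧ W 1 T = 0 ∧ W 2 T = 0

end GreenNaghdi

end

/-! Well-balancing. The LDG derivatives annihilate constants: the flux `wHat` is consistent, so
Green's formula (`TriMesh.volInt_evD`) cancels the volume and face terms. At rest both elliptic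
right-hand sides therefore vanish in turn, and invertibility of the discrete operator forces `K =
0`, then `Z = 0`, then `D = 0`. On a face both reconstructed states equal `(η, 0)`, since `hCheck η
b* + bCheck η b* = η` whatever the sign of `η - b*`. The Lax–Friedrichs dissipation disappears, and
the correction term turns the pressure at the reconstructed bottom into the pressure at the interior
trace of the bottom (`interfaceFlux_rest`). Green's formula for the polynomial `g/2 (η² - 2 η b_h)
φ` then balances flux, topography and interface terms exactly (`IsAtRest.residual`). Only the mass
matrix remains, and it is injective.

Positivity. Testing with `φ = 1` leaves the balance "new volume = old volume minus `Δt` times the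
outgoing face fluxes". Each flux is at most `a` times the interior depth (`interfaceFlux_zero_le`),
because `a` dominates the normal velocities on both sides. In the other direction, the old volume
controls the depth on the faces (`faces_le_volInt`). The map `duffy` turns the integral over `T`
into a Gauss–Lobatto by Gauss sum with nonnegative weights over nodes of `S_T^k`. The layers `u = 0`
and `u = 1` are two faces, weighted by `1 - t` and `t`, and the other layers are dropped. Summing
over the three maps, each face receives `(1 - t) + t = 1`. The Jacobian factor `2|T|` and the
average over three maps give the constant `2/3` of the CFL condition, which compares the two
estimates.

The properties of the quadrature weights (signs, equality of the two end weights) are derived from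
exactness on well-chosen nodal polynomials, without explicit formulas. -/

namespace GreenNaghdi

/-! ### Integration over a triangle -/

/-- The map `(u, v) ↦ v V_i + (1 - v)(u V_{i+1} + (1 - u) V_{i+2})`. -/
noncomputable def duffy (V : Fin 3 → Plane) (i : Fin 3) (u v : ℝ) : Plane :=
  v • V i + (1 - v) • (u • V (i + 1) + (1 - u) • V (i + 2))

/-- The planar cross product. -/
noncomputable def cross (a c : Plane) : ℝ := a 0 * c 1 - a 1 * c 0

/-- Twice the oriented area of a triangle. -/
noncomputable def orient (V : Fin 3 → Plane) : ℝ := cross (V 1 - V 0) (V 2 - V 0)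

theorem cross_sub_sub (V : Fin 3 → Plane) (i : Fin 3) :
    cross (V i - V (i + 2)) (V (i + 1) - V (i + 2)) = orient V := by
  fin_cases i <;> simp [cross, orient] <;> ring

/-- A vanishing cross product makes the two edge vectors at `V 0` dependent, with coefficients given
by their own coordinates. -/
theorem orient_ne_zero {V : Fin 3 → Plane} (hV : AffineIndependent ℝ V) : orient V ≠ 0 := by
  intro h
  simp only [orient, cross, PiLp.sub_apply] at h
  rw [affineIndependent_iff] at hV
  have key : ∀ j : Fin 2, V 1 j = V 0 j ∧ V 2 j = V 0 j := by
    intro j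
    -- These weights represent `(V 2 - V 0) j • (V 1 - V 0) - (V 1 - V 0) j • (V 2 - V 0)`:
    -- coordinate `j` cancels identically and the other coordinate is `± orient V`.
    have h1 := hV Finset.univ
      ![-((V 2 j - V 0 j) - (V 1 j - V 0 j)), V 2 j - V 0 j, -(V 1 j - V 0 j)]
      (by simp [Fin.sum_univ_three]) (by
        ext l
        simp [Fin.sum_univ_three]
        fin_cases j <;> fin_cases l <;> simp <;> linarith)
    have h2 := h1 1 (Finset.mem_univ _)
    have h3 := h1 2 (Finset.mem_univ _)
    simp at h2 h3
    constructor <;> linarith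
  have := hV Finset.univ ![-1, 1, 0] (by simp [Fin.sum_univ_three]) (by
    ext l
    simp [Fin.sum_univ_three, (key l).1]) 1 (Finset.mem_univ _)
  simp at this

theorem duffy_eq_lineMap (V : Fin 3 → Plane) (i : Fin 3) (u v : ℝ) :
    duffy V i u v = AffineMap.lineMap (AffineMap.lineMap (V (i + 2)) (V (i + 1)) u) (V i) v := by
  simp only [duffy, AffineMap.lineMap_apply_module]
  module

theorem exists_affineBasis {V : Fin 3 → Plane} (hV : AffineIndependent ℝ V) :
    ∃ B : AffineBasis (Fin 3) ℝ Plane, ∀ i, B i = V i :=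
  ⟨⟨V, hV, by rw [hV.affineSpan_eq_top_iff_card_eq_finrank_add_one]; simp⟩, fun _ => rfl⟩

theorem coord_duffy (B : AffineBasis (Fin 3) ℝ Plane) {V : Fin 3 → Plane} (hB : ∀ i, B i = V i)
    (i : Fin 3) (u v : ℝ) :
    B.coord i (duffy V i u v) = v ∧ B.coord (i + 1) (duffy V i u v) = (1 - v) * u ∧
      B.coord (i + 2) (duffy V i u v) = (1 - v) * (1 - u) := by
  rw [duffy_eq_lineMap]
  simp only [AffineMap.apply_lineMap, ← hB, AffineBasis.coord_apply]
  simp only [AffineMap.lineMap_apply_module]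
  fin_cases i <;> simp

/-- The barycentric coordinates of the image point are `v`, `(1 - v) u`, `(1 - v)(1 - u)`.
Conversely `v` is the `i`-th coordinate and `u` the next one divided by `1 - v`, which is positive
in the interior. -/
theorem cell_eq_image_duffy {V : Fin 3 → Plane} (hV : AffineIndependent ℝ V) (i : Fin 3) :
    interior (convexHull ℝ (range V)) =
      (fun z : Plane => duffy V i (z 0) (z 1)) '' {z | ∀ j, z j ∈ Ioo (0 : ℝ) 1} := by
  obtain ⟨B, hB⟩ := exists_affineBasis hV
  have hr : range V = range B := by
    congr 1
    ext1 i
    exact (hB i).symm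
  rw [hr, B.interior_convexHull]
  ext x
  simp only [mem_ofPred_eq, mem_image, Fin.forall_fin_two]
  constructor
  · intro hx
    have hs : B.coord i x + B.coord (i + 1) x + B.coord (i + 2) x = 1 := by
      rw [← B.sum_coord_apply_eq_one x, Fin.sum_univ_three]
      fin_cases i <;> simp <;> ring
    have h0 := hx i
    have h1 := hx (i + 1)
    have h2 := hx (i + 2)
    have hpos : 0 < 1 - B.coord i x := by linarith
    refine ⟨!₂[B.coord (i + 1) x / (1 - B.coord i x), B.coord i x], ⟨⟨?_, ?_⟩, ?_, ?_⟩, ?_⟩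
    · simpa using div_pos h1 hpos
    · simp only [Matrix.cons_val_zero]
      rw [div_lt_one hpos]
      linarith
    · simpa using h0
    · simp
      linarith
    · conv_rhs => rw [← B.linear_combination_coord_eq_self x]
      have e1 : (1 - B.coord i x) * (B.coord (i + 1) x / (1 - B.coord i x)) = B.coord (i + 1) x := by
        field_simp
      have e2 : (1 - B.coord i x) * (1 - B.coord (i + 1) x / (1 - B.coord i x))
          = B.coord (i + 2) x := by
        field_simp
        linarith
      simp only [duffy, Matrix.cons_val_zero, Matrix.cons_val_one, smul_add,
        smul_smul, e1, e2, Fin.sum_univ_three, hB]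
      fin_cases i <;> simp <;> abel
  · rintro ⟨z, ⟨⟨h1, h2⟩, h3, h4⟩, rfl⟩ j
    obtain ⟨c0, c1, c2⟩ := coord_duffy B hB i (z 0) (z 1)
    have hj : j = i ∨ j = i + 1 ∨ j = i + 2 := by
      fin_cases i <;> fin_cases j <;> simp
    rcases hj with rfl | rfl | rfl
    · rw [c0]; exact h3
    · rw [c1]; exact mul_pos (by linarith) h1
    · rw [c2]; exact mul_pos (by linarith) (by linarith)

theorem injOn_duffy {V : Fin 3 → Plane} (hV : AffineIndependent ℝ V) (i : Fin 3) :
    InjOn (fun z : Plane => duffy V i (z 0) (z 1)) {z | ∀ j, z j ∈ Ioo (0 : ℝ) 1} := by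
  obtain ⟨B, hB⟩ := exists_affineBasis hV
  intro z hz z' hz' h
  obtain ⟨c0, c1, -⟩ := coord_duffy B hB i (z 0) (z 1)
  obtain ⟨d0, d1, -⟩ := coord_duffy B hB i (z' 0) (z' 1)
  simp only at h
  rw [h] at c0 c1
  have e1 : z 1 = z' 1 := c0.symm.trans d0
  have e0 : (1 - z' 1) * z 0 = (1 - z' 1) * z' 0 := by rw [← d1, c1, e1]
  have hpos : 1 - z' 1 ≠ 0 := by linarith [(hz' 1).2]
  have e0' := mul_left_cancel₀ hpos e0
  ext j
  fin_cases j
  · exact e0'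
  · exact e1

/-- Differential of `duffy`. -/
noncomputable def duffyDeriv (V : Fin 3 → Plane) (i : Fin 3) (z : Plane) : Plane →L[ℝ] Plane :=
  (EuclideanSpace.proj (1 : Fin 2) : Plane →L[ℝ] ℝ).smulRight
      (V i - (z 0 • V (i + 1) + (1 - z 0) • V (i + 2)))
    + (EuclideanSpace.proj (0 : Fin 2) : Plane →L[ℝ] ℝ).smulRight
      ((1 - z 1) • (V (i + 1) - V (i + 2)))

theorem hasFDerivAt_duffy (V : Fin 3 → Plane) (i : Fin 3) (z : Plane) :
    HasFDerivAt (fun z : Plane => duffy V i (z 0) (z 1)) (duffyDeriv V i z) z := by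
  have h0 : HasFDerivAt (fun z : Plane => z 0) (EuclideanSpace.proj (0 : Fin 2) : Plane →L[ℝ] ℝ) z :=
    (EuclideanSpace.proj (0 : Fin 2) : Plane →L[ℝ] ℝ).hasFDerivAt
  have h1 : HasFDerivAt (fun z : Plane => z 1) (EuclideanSpace.proj (1 : Fin 2) : Plane →L[ℝ] ℝ) z :=
    (EuclideanSpace.proj (1 : Fin 2) : Plane →L[ℝ] ℝ).hasFDerivAt
  have := (h1.smul_const (V i)).add ((h1.const_sub 1).smul
    ((h0.smul_const (V (i + 1))).add ((h0.const_sub 1).smul_const (V (i + 2)))))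
  refine this.congr_fderiv ?_
  ext1 w
  simp [duffyDeriv]
  module

/-- The factor `1 - v` reflects the collapse of the side `v = 1` onto the vertex `V i`. -/
theorem det_duffyDeriv (V : Fin 3 → Plane) (i : Fin 3) (z : Plane) :
    (duffyDeriv V i z).det = -((1 - z 1) * orient V) := by
  rw [ContinuousLinearMap.det, ← LinearMap.det_toMatrix
    (EuclideanSpace.basisFun (Fin 2) ℝ).toBasis, Matrix.det_fin_two, ← cross_sub_sub V i]
  simp [LinearMap.toMatrix_apply, duffyDeriv, cross]
  ring

theorem setIntegral_square (f : Plane → ℝ) (hf : Continuous f) :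
    ∫ z in {z : Plane | ∀ j, z j ∈ Ioo (0 : ℝ) 1}, f z
      = ∫ v in (0 : ℝ)..1, ∫ u in (0 : ℝ)..1, f !₂[u, v] := by
  have e1 := (PiLp.volume_preserving_toLp (Fin 2)).setIntegral_preimage_emb
    (MeasurableEquiv.toLp 2 (Fin 2 → ℝ)).measurableEmbedding f {z : Plane | ∀ j, z j ∈ Ioo (0 : ℝ) 1}
  have e2 := (volume_preserving_finTwoArrow ℝ).symm.setIntegral_preimage_emb
    (MeasurableEquiv.finTwoArrow (α := ℝ)).symm.measurableEmbedding
    (fun z : Fin 2 → ℝ => f (WithLp.toLp 2 z))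
    (WithLp.toLp 2 ⁻¹' {z : Plane | ∀ j, z j ∈ Ioo (0 : ℝ) 1})
  have hs : (MeasurableEquiv.finTwoArrow (α := ℝ)).symm ⁻¹'
      (WithLp.toLp 2 ⁻¹' {z : Plane | ∀ j, z j ∈ Ioo (0 : ℝ) 1})
      = Ioo (0 : ℝ) 1 ×ˢ Ioo (0 : ℝ) 1 := by
    ext ⟨u, v⟩
    simp [Fin.forall_fin_two, MeasurableEquiv.finTwoArrow, and_assoc]
  rw [← e1, ← e2, hs, Measure.volume_eq_prod]
  have hc : Continuous fun p : ℝ × ℝ => f (WithLp.toLp 2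
      ((MeasurableEquiv.finTwoArrow (α := ℝ)).symm p)) := by
    refine hf.comp ((PiLp.continuous_toLp 2 _).comp ?_)
    refine continuous_pi fun j => ?_
    fin_cases j
    · exact continuous_fst
    · exact continuous_snd
  have hi : IntegrableOn (fun p : ℝ × ℝ => f (WithLp.toLp 2
      ((MeasurableEquiv.finTwoArrow (α := ℝ)).symm p))) (Ioo (0 : ℝ) 1 ×ˢ Ioo (0 : ℝ) 1)
      (volume.prod volume) :=
    ((hc.continuousOn.integrableOn_compact (isCompact_Icc.prod isCompact_Icc)).mono_set
      (prod_mono Ioo_subset_Icc_self Ioo_subset_Icc_self))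
  -- The swap makes `v` the outer variable, so that the Jacobian factor `1 - v` can stay outside the
  -- `u`-integral.
  rw [← setIntegral_prod_swap, setIntegral_prod]
  · simp only [intervalIntegral.integral_of_le zero_le_one, integral_Ioc_eq_integral_Ioo]
    rfl
  · exact hi.swap

theorem setIntegral_triangle {V : Fin 3 → Plane} (hV : AffineIndependent ℝ V) (i : Fin 3)
    {f : Plane → ℝ} (hf : Continuous f) :
    ∫ x in interior (convexHull ℝ (range V)), f x
      = |orient V| * ∫ v in (0 : ℝ)..1, (1 - v) * ∫ u in (0 : ℝ)..1, f (duffy V i u v) := by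
  have hm : MeasurableSet {z : Plane | ∀ j, z j ∈ Ioo (0 : ℝ) 1} := by
    have : {z : Plane | ∀ j, z j ∈ Ioo (0 : ℝ) 1} = ⋂ j, (fun z : Plane => z j) ⁻¹' Ioo 0 1 := by
      ext; simp
    rw [this]
    exact MeasurableSet.iInter fun j => (isOpen_Ioo.preimage (by fun_prop)).measurableSet
  rw [cell_eq_image_duffy hV i, integral_image_eq_integral_abs_det_fderiv_smul volume hm
    (fun z _ => (hasFDerivAt_duffy V i z).hasFDerivWithinAt) (injOn_duffy hV i)]
  have hcd : Continuous fun z : Plane => duffy V i (z 0) (z 1) := by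
    unfold duffy; fun_prop
  have : ∀ z ∈ {z : Plane | ∀ j, z j ∈ Ioo (0 : ℝ) 1},
      |(duffyDeriv V i z).det| • f (duffy V i (z 0) (z 1))
        = |orient V| * ((1 - z 1) * f (duffy V i (z 0) (z 1))) := by
    intro z hz
    have h1 : 0 < 1 - z 1 := by linarith [(hz 1).2]
    rw [det_duffyDeriv, abs_neg, abs_mul, abs_of_pos h1, smul_eq_mul]
    ring
  rw [setIntegral_congr_fun hm this, integral_const_mul, setIntegral_square _ (by fun_prop)]
  simp

/-! ### Polynomials on a triangle -/

@[simp] theorem ev_zero (x : Plane) : ev 0 x = 0 := by simp [ev]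
@[simp] theorem ev_one (x : Plane) : ev 1 x = 1 := by simp [ev]
@[simp] theorem ev_C (r : ℝ) (x : Plane) : ev (MvPolynomial.C r) x = r := by simp [ev]
theorem ev_add (p q : MvPolynomial (Fin 2) ℝ) (x : Plane) : ev (p + q) x = ev p x + ev q x := by
  simp [ev]
theorem ev_sub (p q : MvPolynomial (Fin 2) ℝ) (x : Plane) : ev (p - q) x = ev p x - ev q x := by
  simp [ev]
theorem ev_mul (p q : MvPolynomial (Fin 2) ℝ) (x : Plane) : ev (p * q) x = ev p x * ev q x := by
  simp [ev]
@[simp] theorem evD_one (j : Fin 2) (x : Plane) : evD j 1 x = 0 := by simp [evD]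
@[simp] theorem evD_C (j : Fin 2) (r : ℝ) (x : Plane) : evD j (MvPolynomial.C r) x = 0 := by
  simp [evD]
theorem evD_add (j : Fin 2) (p q : MvPolynomial (Fin 2) ℝ) (x : Plane) :
    evD j (p + q) x = evD j p x + evD j q x := by
  simp [evD, ev_add]
theorem evD_sub (j : Fin 2) (p q : MvPolynomial (Fin 2) ℝ) (x : Plane) :
    evD j (p - q) x = evD j p x - evD j q x := by
  simp [evD, ev_sub]
theorem evD_mul (j : Fin 2) (p q : MvPolynomial (Fin 2) ℝ) (x : Plane) :
    evD j (p * q) x = evD j p x * ev q x + ev p x * evD j q x := by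
  simp only [evD, ev, MvPolynomial.pderiv_mul, map_add, map_mul]

@[fun_prop] theorem continuous_ev (p : MvPolynomial (Fin 2) ℝ) : Continuous (ev p) := by
  have h : Continuous fun x : Plane => (fun i => x i : Fin 2 → ℝ) := by fun_prop
  exact (MvPolynomial.continuous_eval p).comp h

@[fun_prop] theorem continuous_evD (j : Fin 2) (p : MvPolynomial (Fin 2) ℝ) :
    Continuous (evD j p) := continuous_ev _

theorem hasDerivAt_ev_comp (p : MvPolynomial (Fin 2) ℝ) {γ : ℝ → Plane} {d : Plane} {t : ℝ}
    (hγ : ∀ j, HasDerivAt (fun s => γ s j) (d j) t) :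
    HasDerivAt (fun s => ev p (γ s)) (∑ j, evD j p (γ t) * d j) t := by
  induction p using MvPolynomial.induction_on with
  | C a => simpa using hasDerivAt_const t a
  | add p q hp hq =>
    simp only [ev_add, evD_add, add_mul, Finset.sum_add_distrib]
    exact hp.add hq
  | mul_X p n hp =>
    have h := hp.mul (hγ n)
    have e : ∀ x : Plane, ev (MvPolynomial.X n) x = x n := fun x => by simp [ev]
    have e' : ∀ (j : Fin 2) (x : Plane), evD j (MvPolynomial.X n) x = if j = n then 1 else 0 := by
      intro j x
      simp only [evD, MvPolynomial.pderiv_X, Pi.single_apply, ev]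
      by_cases hjn : j = n
      · simp [hjn]
      · simp [hjn, Ne.symm hjn]
    simp only [ev_mul, evD_mul, e, e']
    refine h.congr_deriv ?_
    simp only [add_mul, Finset.sum_add_distrib, mul_ite, ite_mul, mul_one, mul_zero, zero_mul,
      Finset.sum_ite_eq', Finset.mem_univ, if_true, Finset.sum_mul]
    congr 1
    exact Finset.sum_congr rfl fun j _ => by ring

/-- The `u`-derivative of `p ∘ duffy` is `1 - v` times the derivative of `p` along this edge. The
Jacobian supplies exactly that factor, so the inner integral is a difference of values on two sides;
the side parallel to the direction does not contribute. -/
theorem setIntegral_dirDeriv {V : Fin 3 → Plane} (hV : AffineIndependent ℝ V) (i : Fin 3)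
    (p : MvPolynomial (Fin 2) ℝ) :
    ∫ x in interior (convexHull ℝ (range V)), ∑ j, evD j p x * (V (i + 1) - V (i + 2)) j
      = |orient V| * ((∫ t in (0 : ℝ)..1, ev p (AffineMap.lineMap (V i) (V (i + 1)) t))
          - ∫ t in (0 : ℝ)..1, ev p (AffineMap.lineMap (V (i + 2)) (V i) t)) := by
  rw [setIntegral_triangle hV i (by fun_prop)]
  have hin : ∀ v : ℝ, (1 - v) * ∫ u in (0 : ℝ)..1,
      ∑ j, evD j p (duffy V i u v) * (V (i + 1) - V (i + 2)) j
        = ev p (duffy V i 1 v) - ev p (duffy V i 0 v) := by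
    intro v
    have hc : Continuous fun u => duffy V i u v := by unfold duffy; fun_prop
    rw [← intervalIntegral.integral_const_mul]
    refine intervalIntegral.integral_eq_sub_of_hasDerivAt (f := fun u => ev p (duffy V i u v)) ?_ ?_
    · intro u _
      refine (hasDerivAt_ev_comp (γ := fun u => duffy V i u v)
        (d := (1 - v) • (V (i + 1) - V (i + 2))) p fun j => ?_).congr_deriv ?_
      · simp only [duffy, PiLp.add_apply, PiLp.smul_apply, PiLp.sub_apply, smul_eq_mul]
        have h := ((((hasDerivAt_id u).mul_const (V (i + 1) j)).add
          (((hasDerivAt_id u).const_sub 1).mul_const (V (i + 2) j))).const_mul (1 - v)).const_add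
            (v * V i j)
        refine h.congr_deriv ?_
        ring
      · rw [Finset.mul_sum]
        refine Finset.sum_congr rfl fun j _ => ?_
        simp
        ring
    · exact Continuous.intervalIntegrable (by fun_prop) _ _
  have hd : ∀ u : ℝ, Continuous fun v => ev p (duffy V i u v) := by
    intro u; unfold duffy; fun_prop
  simp only [hin]
  rw [intervalIntegral.integral_sub ((hd 1).intervalIntegrable _ _)
    ((hd 0).intervalIntegrable _ _)]
  congr 2
  · have := intervalIntegral.integral_comp_sub_left (a := 0) (b := 1)
      (fun t => ev p (AffineMap.lineMap (V i) (V (i + 1)) t)) 1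
    simp only [sub_zero, sub_self] at this
    rw [← this]
    simp [duffy_eq_lineMap, AffineMap.lineMap_apply_one_sub]
  · simp [duffy_eq_lineMap]

/-- The inner product tested in `triNormal` equals `-orient V`, so the case distinction there
amounts to the sign of `orient V`, the same for all three faces. -/
theorem len_mul_triNormal {V : Fin 3 → Plane} (hV : AffineIndependent ℝ V) (i : Fin 3)
    (j : Fin 2) :
    dist (V (i + 1)) (V (i + 2)) * triNormal V i j
      = |orient V| / orient V * rot (V (i + 2) - V (i + 1)) j := by
  have h0 := orient_ne_zero hV
  have hne : ‖V (i + 2) - V (i + 1)‖ ≠ 0 := by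
    rw [norm_ne_zero_iff, sub_ne_zero]
    intro h
    have := hV.injective h
    revert this
    fin_cases i <;> decide
  have hin : inner ℝ (rot (V (i + 2) - V (i + 1))) (V i - V (i + 1)) = -orient V := by
    rw [← cross_sub_sub V i]
    simp [rot, cross, PiLp.inner_apply]
    ring
  rw [dist_comm, dist_eq_norm]
  unfold triNormal
  rw [hin]
  rcases lt_or_gt_of_ne h0 with h | h
  · rw [if_neg (by linarith), abs_of_neg h]
    simp only [PiLp.neg_apply, PiLp.smul_apply, smul_eq_mul]
    field_simp
  · rw [if_pos (by linarith), abs_of_pos h]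
    simp only [PiLp.smul_apply, smul_eq_mul]
    field_simp

/-! ### Geometry of mesh elements and Green's formula -/

namespace TriMesh

variable (M : TriMesh)

theorem len_pos (T : M.Elt) (i : Fin 3) : 0 < M.len T i := by
  refine dist_pos.2 fun h => ?_
  have := (M.nondegenerate T).injective h
  revert this
  fin_cases i <;> decide

theorem normal_sq (T : M.Elt) (i : Fin 3) : M.normal T i 0 ^ 2 + M.normal T i 1 ^ 2 = 1 := by
  have h0 := orient_ne_zero (M.nondegenerate T)
  have hl := M.len_pos T i
  have e0 := len_mul_triNormal (M.nondegenerate T) i 0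
  have e1 := len_mul_triNormal (M.nondegenerate T) i 1
  have hd : M.len T i ^ 2 = (M.vert T (i + 1) 0 - M.vert T (i + 2) 0) ^ 2
      + (M.vert T (i + 1) 1 - M.vert T (i + 2) 1) ^ 2 := by
    rw [len, EuclideanSpace.dist_eq, Real.sq_sqrt (by positivity)]
    simp [Real.dist_eq]
  have hs : (|orient (M.vert T)| / orient (M.vert T)) ^ 2 = 1 := by
    rw [div_pow, sq_abs, div_self (by positivity)]
  change M.len T i * M.normal T i 0 = _ at e0
  change M.len T i * M.normal T i 1 = _ at e1
  simp only [rot, PiLp.sub_apply] at e0 e1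
  simp at e0 e1
  have : M.len T i ^ 2 * (M.normal T i 0 ^ 2 + M.normal T i 1 ^ 2) = M.len T i ^ 2 * 1 := by
    rw [mul_add, ← mul_pow, ← mul_pow, e0, e1, mul_pow, mul_pow, hs, hd]
    ring
  exact mul_left_cancel₀ (by positivity) this

theorem continuous_pt (T : M.Elt) (i : Fin 3) : Continuous (M.pt T i) :=
  AffineMap.lineMap_continuous

theorem integrableOn_cell {f : Plane → ℝ} (hf : Continuous f) (T : M.Elt) :
    IntegrableOn f (M.cell T) :=
  (hf.continuousOn.integrableOn_compact
    ((Set.finite_range _).isCompact_convexHull (𝕜 := ℝ))).mono_set interior_subset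

/-- Green's formula. The derivatives along two edges, known from `setIntegral_dirDeriv`, form a
linear system for the two partial derivatives with determinant `orient`, up to sign; Cramer's rule
solves it. -/
theorem volInt_evD (T : M.Elt) (p : MvPolynomial (Fin 2) ℝ) (j : Fin 2) :
    M.volInt T (evD j p) = ∑ i, M.faceInt T i fun t => M.normal T i j * ev p (M.pt T i t) := by
  have hV := M.nondegenerate T
  have h0 := orient_ne_zero hV
  set V := M.vert T with hVdef
  set D := orient V with hD
  have hn : ∀ i, M.faceInt T i (fun t => M.normal T i j * ev p (M.pt T i t))
      = |D| / D * rot (V (i + 2) - V (i + 1)) j * ∫ t in (0 : ℝ)..1, ev p (M.pt T i t) := by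
    intro i
    rw [faceInt, intervalIntegral.integral_const_mul, ← mul_assoc, ← len_mul_triNormal hV]
    rfl
  have hdir : ∀ i, M.volInt T (evD 0 p) * (V (i + 1) - V (i + 2)) 0
      + M.volInt T (evD 1 p) * (V (i + 1) - V (i + 2)) 1
      = |D| * ((∫ t in (0 : ℝ)..1, ev p (AffineMap.lineMap (V i) (V (i + 1)) t))
          - ∫ t in (0 : ℝ)..1, ev p (AffineMap.lineMap (V (i + 2)) (V i) t)) := by
    intro i
    rw [← setIntegral_dirDeriv hV i p]
    simp only [Fin.sum_univ_two]
    rw [integral_add, integral_mul_const, integral_mul_const]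
    · rfl
    · exact M.integrableOn_cell (by fun_prop) T
    · exact M.integrableOn_cell (by fun_prop) T
  have d0 := hdir 0
  have d1 := hdir 1
  simp only [hn, Fin.sum_univ_three]
  simp only [pt, ← hVdef]
  simp only [zero_add, show (1 : Fin 3) + 1 = 2 from rfl, show (1 : Fin 3) + 2 = 0 from rfl,
    show (2 : Fin 3) + 1 = 0 from rfl, show (2 : Fin 3) + 2 = 1 from rfl] at d0 d1 ⊢
  have hDe : D = (V 1 - V 0) 0 * (V 2 - V 0) 1 - (V 1 - V 0) 1 * (V 2 - V 0) 0 := rfl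
  simp only [PiLp.sub_apply] at d0 d1 hDe
  generalize (∫ t in (0 : ℝ)..1, ev p (AffineMap.lineMap (V 0) (V 1) t)) = I2 at *
  generalize (∫ t in (0 : ℝ)..1, ev p (AffineMap.lineMap (V 1) (V 2) t)) = I0 at *
  generalize (∫ t in (0 : ℝ)..1, ev p (AffineMap.lineMap (V 2) (V 0) t)) = I1 at *
  apply mul_right_cancel₀ h0
  rw [show ∀ x y z : ℝ, (|D| / D * x * I0 + |D| / D * y * I1 + |D| / D * z * I2) * D
    = |D| * (x * I0 + y * I1 + z * I2) from fun x y z => by field_simp]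
  fin_cases j
  · simp [rot]
    rw [hDe] at d0 d1 ⊢
    linear_combination (V 2 1 - V 0 1) * d0 - (V 1 1 - V 2 1) * d1
  · simp [rot]
    rw [hDe] at d0 d1 ⊢
    linear_combination (V 1 0 - V 2 0) * d1 - (V 2 0 - V 0 0) * d0

theorem cell_nonempty (T : M.Elt) : (M.cell T).Nonempty := by
  rw [cell, cell_eq_image_duffy (M.nondegenerate T) 0]
  exact ⟨_, !₂[1 / 2, 1 / 2], by simp [Fin.forall_fin_two]; norm_num, rfl⟩

theorem area_eq (T : M.Elt) : M.area T = |orient (M.vert T)| / 2 := by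
  have h := setIntegral_triangle (M.nondegenerate T) 0 (f := fun _ => 1) continuous_const
  have h1 : ∫ v in (0 : ℝ)..1, (1 - v) = 1 / 2 := by
    rw [intervalIntegral.integral_sub] <;> simp
    norm_num
  simp [measureReal_def, h1] at h
  rw [area, cell, h]
  ring

theorem area_pos (T : M.Elt) : 0 < M.area T := by
  rw [area_eq]
  have := abs_pos.2 (orient_ne_zero (M.nondegenerate T))
  positivity

end TriMesh

/-! ### Uniqueness of polynomials on a cell and restriction to lines -/

theorem eq_zero_of_ev_eq_zero {p : MvPolynomial (Fin 2) ℝ} {s : Set Plane} (hs : IsOpen s)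
    (hne : s.Nonempty) (h : ∀ x ∈ s, ev p x = 0) : p = 0 := by
  obtain ⟨x, hx⟩ := hne
  have ho : IsOpen (WithLp.toLp 2 ⁻¹' s : Set (Fin 2 → ℝ)) :=
    hs.preimage (PiLp.continuous_toLp 2 _)
  obtain ⟨r, hr, hb⟩ := Metric.isOpen_iff.1 ho (WithLp.ofLp x) hx
  rw [ball_pi _ hr] at hb
  refine MvPolynomial.funext_set (s := fun i => Metric.ball (x i) r) ?_ fun y hy => ?_
  · intro i
    rw [Real.ball_eq_Ioo]
    exact Ioo_infinite (by linarith)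
  · have := h _ (hb hy)
    simpa [ev] using this

theorem eq_zero_of_volInt_sq {M : TriMesh} {T : M.Elt} {p : MvPolynomial (Fin 2) ℝ}
    (h : M.volInt T (fun x => ev p x * ev p x) = 0) : p = 0 := by
  have hi := M.integrableOn_cell (f := fun x => ev p x * ev p x) (by fun_prop) T
  rw [TriMesh.volInt, setIntegral_eq_zero_iff_of_nonneg_ae
    (Filter.Eventually.of_forall fun x => mul_self_nonneg _) hi] at h
  have := Measure.eqOn_open_of_ae_eq h isOpen_interior (Continuous.continuousOn (by fun_prop))
    continuousOn_const
  exact eq_zero_of_ev_eq_zero isOpen_interior (M.cell_nonempty T)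
    fun x hx => mul_self_eq_zero.1 (this hx)

/-- Injectivity of the local mass matrix: test with `φ = p - q`. -/
theorem Pk.eq_of_volInt {M : TriMesh} {k : ℕ} {T : M.Elt} {p q : Pk k}
    (h : ∀ φ : Pk k, M.volInt T (fun x => ev p x * ev φ x) = M.volInt T (fun x => ev q x * ev φ x)) :
    p = q := by
  rw [← sub_eq_zero]
  refine Subtype.ext (eq_zero_of_volInt_sq (M := M) (T := T) ?_)
  have h1 := h (p - q)
  rw [← sub_eq_zero, TriMesh.volInt, TriMesh.volInt, ← integral_sub] at h1
  · rw [← h1]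
    refine integral_congr_ae (Filter.Eventually.of_forall fun x => ?_)
    simp [ev_sub]
    ring
  · exact M.integrableOn_cell (by fun_prop) T
  · exact M.integrableOn_cell (by fun_prop) T

/-- Brings the one-dimensional quadrature rules to bear on bivariate polynomials along segments. -/
theorem exists_polynomial_lineMap {k : ℕ} (p : Pk k) (a c : Plane) :
    ∃ r : Polynomial ℝ, r.natDegree ≤ k ∧ ∀ t, r.eval t = ev p (AffineMap.lineMap a c t) := by
  refine ⟨MvPolynomial.aeval (fun i => Polynomial.C (c i - a i) * Polynomial.X
    + Polynomial.C (a i)) (p : MvPolynomial (Fin 2) ℝ), ?_, fun t => ?_⟩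
  · have := MvPolynomial.aeval_natDegree_le (R := ℝ) (p : MvPolynomial (Fin 2) ℝ)
      ((MvPolynomial.mem_restrictTotalDegree (Fin 2) k _).1 p.2)
      (fun i => Polynomial.C (c i - a i) * Polynomial.X + Polynomial.C (a i)) (n := 1)
      (fun i => Polynomial.natDegree_linear_le)
    simpa using this
  · rw [ev, ← Polynomial.coe_evalRingHom, MvPolynomial.aeval_def, MvPolynomial.hom_eval₂]
    rw [MvPolynomial.eval, MvPolynomial.coe_eval₂Hom]
    congr 1
    · ext; simp
    · ext i
      simp [AffineMap.lineMap_apply_module]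
      ring

section AtRest

/-! ### The dispersive source at rest -/

variable {M : TriMesh} {k : ℕ}

@[simp] theorem TriMesh.volInt_zero (T : M.Elt) : M.volInt T (fun _ => 0) = 0 := by
  simp [TriMesh.volInt]

@[simp] theorem TriMesh.faceInt_zero (T : M.Elt) (i : Fin 3) : M.faceInt T i (fun _ => 0) = 0 := by
  simp [TriMesh.faceInt]

theorem TriMesh.volInt_const_mul (T : M.Elt) (c : ℝ) (f : Plane → ℝ) :
    M.volInt T (fun x => c * f x) = c * M.volInt T f := by
  simp [TriMesh.volInt, integral_const_mul]

theorem TriMesh.faceInt_const_mul (T : M.Elt) (i : Fin 3) (c : ℝ) (f : ℝ → ℝ) :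
    M.faceInt T i (fun t => c * f t) = c * M.faceInt T i f := by
  simp only [TriMesh.faceInt, intervalIntegral.integral_const_mul]
  ring

/-- The zero polynomial is a representer, so the choice in `riesz` meets its specification, and
injectivity of the mass matrix identifies it. -/
theorem riesz_eq_zero {T : M.Elt} {ℓ : Pk k → ℝ} (h : ∀ φ, ℓ φ = 0) : riesz M T ℓ = 0 := by
  have hs : ∃ p : Pk k, ∀ φ : Pk k, M.volInt T (fun x => ev p x * ev φ x) = ℓ φ :=
    ⟨0, fun φ => by simp [h]⟩
  refine Pk.eq_of_volInt (T := T) fun φ => ?_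
  rw [riesz, Classical.epsilon_spec hs φ, h]
  simp

theorem interp_eq_zero (X : Nodes M k) {f : M.Elt → Plane → ℝ} (h : ∀ T x, f T x = 0) :
    interp X f = 0 := by
  funext T
  obtain ⟨p, hp, hu⟩ := X.unisolvent T fun i => f T (X.node T i)
  have hs : ∃ p : Pk k, ∀ i, ev p (X.node T i) = f T (X.node T i) := ⟨p, hp⟩
  rw [interp, hu _ (Classical.epsilon_spec hs)]
  exact (hu 0 fun i => by simp [h]).symm

theorem ext_of_const {u : Field M k} {c : ℝ} (hu : ∀ T x, ev (u T) x = c) (T : M.Elt) (i : Fin 3)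
    (t : ℝ) : ext u T i t = c := by
  unfold ext
  split
  · exact hu _ _
  · exact hu _ _

@[simp] theorem tr_zero (T : M.Elt) (i : Fin 3) (t : ℝ) : tr (0 : Field M k) T i t = 0 := by
  simp [tr]

@[simp] theorem ext_zero (T : M.Elt) (i : Fin 3) (t : ℝ) : ext (0 : Field M k) T i t = 0 :=
  ext_of_const (fun T x => by simp) T i t

@[simp] theorem extV_zero (T : M.Elt) (i : Fin 3) (t : ℝ) (c : Fin 2) :
    extV (0 : VField M k) T i t c = 0 := by
  unfold extV
  split <;> simp

@[simp] theorem extT_zero (T : M.Elt) (i : Fin 3) (t : ℝ) (c j : Fin 2) :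
    extT (0 : Fin 2 → VField M k) T i t c j = 0 := by
  unfold extT
  split <;> simp

/-- With equal traces the flux is `c` for every upwinding parameter, and Green's formula for `φ`
cancels the two terms. -/
theorem ldgGrad_of_const (P : Params) {u : Field M k} {up : M.Elt → Fin 3 → ℝ → ℝ} {c : ℝ}
    (hu : ∀ T x, ev (u T) x = c) (hup : ∀ T i t, up T i t = c) : ldgGrad P u up = 0 := by
  funext j T
  refine riesz_eq_zero fun φ => ?_
  have hw : ∀ n, wHat P n c c = c := fun n => by simp [wHat]
  simp only [tr, hu, hup, hw, mul_assoc, M.volInt_const_mul, M.faceInt_const_mul]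
  rw [← Finset.mul_sum, show M.volInt T (fun x => evD j φ x) = _ from M.volInt_evD T φ j]
  simp [M.faceInt_const_mul]

theorem ldgHess_of_const (P : Params) {u : Field M k} {up : M.Elt → Fin 3 → ℝ → ℝ} {c : ℝ}
    {p : VField M k} {pp : M.Elt → Fin 3 → ℝ → Fin 2 → ℝ}
    (hu : ∀ T x, ev (u T) x = c) (hup : ∀ T i t, up T i t = c) (hp : p = 0)
    (hpp : ∀ T i t j, pp T i t j = 0) : ldgHess P u up p pp = 0 := by
  funext j l T
  subst hp
  refine riesz_eq_zero fun φ => ?_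
  simp [tr, hu, hup, hpp, pHat]

theorem grad_of_const (P : Params) {u : Field M k} {c : ℝ} (hu : ∀ T x, ev (u T) x = c) :
    grad P u = 0 :=
  ldgGrad_of_const P hu (ext_of_const hu)

theorem hess_of_const (P : Params) {u : Field M k} {c : ℝ} (hu : ∀ T x, ev (u T) x = c) :
    hess P u = 0 := by
  refine ldgHess_of_const P hu (ext_of_const hu) (grad_of_const P hu) fun T i t j => ?_
  rw [grad_of_const P hu, extV_zero]

@[simp] theorem grad_zero (P : Params) : grad P (0 : Field M k) = 0 :=
  grad_of_const P (c := 0) fun T x => by simp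

@[simp] theorem gradV_zero (P : Params) : gradV P (0 : VField M k) = 0 := by
  funext c
  exact ldgGrad_of_const P (c := 0) (fun T x => by simp) (by simp)

@[simp] theorem hessV_zero (P : Params) : hessV P (0 : VField M k) = 0 := by
  funext c
  exact ldgHess_of_const P (c := 0) (fun T x => by simp) (by simp) (by simp) (by simp)

theorem R₁_zero (X : Nodes M k) (P : Params) (h b : Field M k) : R₁ X P h b 0 = 0 := by
  funext c
  refine interp_eq_zero X fun T x => ?_
  rw [interp_eq_zero X (f := fun T x => ev (h T) x ^ 3 * ev ((0 : Field M k) T) x) (by simp)]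
  simp

theorem R₂_zero (X : Nodes M k) (P : Params) (h b : Field M k) : R₂ X P h b 0 = 0 := by
  funext c
  refine interp_eq_zero X fun T x => ?_
  rw [interp_eq_zero X (f := fun T x => ev (h T) x ^ 2 * ev ((0 : Field M k) T) x) (by simp)]
  simp

theorem Q₁_zero (X : Nodes M k) (P : Params) (h b : Field M k) : Q₁ X P h b 0 = 0 := by
  unfold Q₁
  rw [interp_eq_zero X, interp_eq_zero X, R₁_zero, R₂_zero]
  · simp
  · simp
  · simp

theorem Q₂_of_const (X : Nodes M k) (P : Params) (h b : Field M k) {ζ : Field M k} {c : ℝ}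
    (hζ : ∀ T x, ev (ζ T) x = c) : Q₂ X P h b ζ = 0 := by
  funext d
  refine interp_eq_zero X fun T x => ?_
  rw [interp_eq_zero X (f := fun T x => ev (h T) x ^ 2 *
    ∑ j, ev (grad P b j T) x * ev (grad P ζ j T) x) (by simp [grad_of_const P hζ])]
  rw [grad_of_const P hζ, hess_of_const P hζ]
  fin_cases d <;> simp [perpTerm]

theorem Q₃_zero (X : Nodes M k) (P : Params) (m : Field M k) : Q₃ X P m 0 = 0 := by
  funext d
  refine interp_eq_zero X fun T x => ?_
  simp

theorem source₁_of_const (X : Nodes M k) (P : Params) (h : Field M k) {η : Field M k} {c : ℝ}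
    (hη : ∀ T x, ev (η T) x = c) : source₁ X P h η = 0 := by
  funext d
  refine interp_eq_zero X fun T x => ?_
  simp [grad_of_const P hη]

theorem source₂_of_const (X : Nodes M k) (P : Params) (h b : Field M k) {η : Field M k}
    (m : Field M k) {c : ℝ} (hη : ∀ T x, ev (η T) x = c) : source₂ X P h b η m 0 0 = 0 := by
  funext d
  refine interp_eq_zero X fun T x => ?_
  simp [grad_of_const P hη, Q₁_zero, Q₂_of_const X P h b hη, Q₃_zero]

theorem isLDGSolution_zero (P : Params) (b : Plane → ℝ) :
    IsLDGSolution P b (0 : VField M k) 0 0 := by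
  constructor <;> intros <;> simp [pHat, wHat]

theorem LDGWellPosed.eq_zero {P : Params} {b : Plane → ℝ} (h : LDGWellPosed M k P b)
    {w : VField M k} {p : Fin 2 → VField M k} (hw : IsLDGSolution P b w p 0) : w = 0 :=
  congrArg Prod.fst ((h 0).unique (y₁ := (w, p)) (y₂ := (0, 0)) hw (isLDGSolution_zero P b))

theorem IsAtRest.ev_zero {ηe : ℝ} {W : State M k} (hW : IsAtRest ηe W) (T : M.Elt) (x : Plane) :
    ev (W 0 T) x = ηe := by
  rw [(hW T).1, ev_C]

theorem IsAtRest.apply_one {ηe : ℝ} {W : State M k} (hW : IsAtRest ηe W) : W 1 = 0 :=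
  funext fun T => (hW T).2.1

theorem IsAtRest.apply_two {ηe : ℝ} {W : State M k} (hW : IsAtRest ηe W) : W 2 = 0 :=
  funext fun T => (hW T).2.2

theorem IsAtRest.discharge {ηe : ℝ} {W : State M k} (hW : IsAtRest ηe W) :
    (![W 1, W 2] : VField M k) = 0 := by
  funext c
  fin_cases c
  · exact hW.apply_one
  · exact hW.apply_two

/-- The two elliptic problems are solved in order: the first source vanishes, so `K = 0`; this makes
the second source vanish, so `Z = 0`. Dry nodes are harmless because every quotient has numerator
zero. -/
theorem IsAtRest.isDispersiveSource_iff (X : Nodes M k) {P : Params} {b : Plane → ℝ}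
    (hP : LDGWellPosed M k P b) {ηe : ℝ} {W : State M k} (hW : IsAtRest ηe W) (D : State M k) :
    IsDispersiveSource X P b W D ↔ D = 0 := by
  have hv : (fun c => interp X fun T x => ev ((![W 1, W 2] : VField M k) c T) x
      / ev ((W 0 - l2proj M k b) T) x : VField M k) = 0 := by
    funext c
    refine interp_eq_zero X fun T x => ?_
    rw [hW.discharge]
    simp
  unfold IsDispersiveSource
  simp only [hv, source₁_of_const X P _ hW.ev_zero]
  constructor
  · rintro ⟨K, Z, pK, pZ, hK, hZ, h0, h1, h2⟩
    rw [hP.eq_zero hK, source₂_of_const X P _ _ _ hW.ev_zero] at hZ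
    rw [hP.eq_zero hZ] at h1 h2
    funext c
    fin_cases c
    · exact h0
    · simpa using h1
    · simpa using h2
  · rintro rfl
    refine ⟨0, 0, 0, 0, isLDGSolution_zero P b, ?_, rfl, by simp, by simp⟩
    rw [source₂_of_const X P _ _ _ hW.ev_zero]
    exact isLDGSolution_zero P b

/-! ### The advective part at rest -/

/-- Positive part minus negative part of `η - bs`; this is why no sign of the depth is needed for
well-balancing. -/
theorem hCheck_add_bCheck (η bs : ℝ) : hCheck η bs + bCheck η bs = η := by
  unfold hCheck bCheck
  rcases le_total η bs with h | h
  · rw [max_eq_left (by linarith), max_eq_right (by linarith)]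
    ring
  · rw [max_eq_right (by linarith), max_eq_left (by linarith)]
    ring

/-- Both reconstructed states are `(η, 0)`, so no dissipation remains, and `g/2 (η² - 2 η b̌) + g η
(b̌ - b⁻) = g/2 (η² - 2 η b⁻)`. -/
theorem interfaceFlux_rest (P : Params) (a η bm bp : ℝ) (n : Plane) (c : Fin 3) :
    interfaceFlux P a ![η, 0, 0] ![η, 0, 0] bm bp n c
      = ![0, P.g / 2 * (η ^ 2 - 2 * η * bm) * n 0, P.g / 2 * (η ^ 2 - 2 * η * bm) * n 1] c := by
  have h := hCheck_add_bCheck η (max bm bp)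
  fin_cases c <;> simp [interfaceFlux, laxFriedrichs, wCheck, flux, h] <;> ring

theorem IsAtRest.trW_eq {ηe : ℝ} {W : State M k} (hW : IsAtRest ηe W) (T : M.Elt) (i : Fin 3)
    (t : ℝ) : trW W T i t = ![ηe, 0, 0] := by
  funext c
  fin_cases c
  · exact hW.ev_zero _ _
  · simp [trW, hW.apply_one]
  · simp [trW, hW.apply_two]

theorem IsAtRest.extW_eq {ηe : ℝ} {W : State M k} (hW : IsAtRest ηe W) (T : M.Elt) (i : Fin 3)
    (t : ℝ) : extW W T i t = ![ηe, 0, 0] := by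
  simp [extW, hW.discharge, ext_of_const hW.ev_zero]

/-- By the product rule, differentiating `g/2 (ηe² - 2 ηe b_h) φ` produces the pressure term and the
topography term together, and Green's formula turns them into the face terms. -/
theorem IsAtRest.residual {ηe : ℝ} {W : State M k} (hW : IsAtRest ηe W) (P : Params)
    (bh : Field M k) (T : M.Elt) (c : Fin 3) (φ : Pk k) :
    M.volInt T (fun x => ∑ j, flux P (fun d => ev (W d T) x) (ev (bh T) x) c j * evD j φ x)
      + M.volInt T (fun x =>
          topoSource P (ev (W 0 T) x) (fun j => evD j (bh T) x) c * ev φ x)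
      = ∑ i, M.faceInt T i (fun t => numFlux P bh W T i t c * ev φ (M.pt T i t)) := by
  have key : ∀ j : Fin 2,
      M.volInt T (fun x => P.g / 2 * (ηe ^ 2 - 2 * ηe * ev (bh T) x) * evD j φ x)
        + M.volInt T (fun x => -(P.g * ηe * evD j (bh T) x) * ev φ x)
      = ∑ i, M.faceInt T i (fun t => P.g / 2 * (ηe ^ 2 - 2 * ηe * tr bh T i t) * M.normal T i j
          * ev φ (M.pt T i t)) := by
    intro j
    have h := M.volInt_evD T (MvPolynomial.C (P.g / 2) *
      (MvPolynomial.C (ηe ^ 2) - MvPolynomial.C (2 * ηe) * (bh T : MvPolynomial (Fin 2) ℝ)) *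
        (φ : MvPolynomial (Fin 2) ℝ)) j
    simp only [ev_mul, ev_sub, ev_C] at h
    rw [TriMesh.volInt, TriMesh.volInt, ← integral_add]
    · refine Eq.trans ?_ (h.trans ?_)
      · refine integral_congr_ae (Filter.Eventually.of_forall fun x => ?_)
        simp only [evD_mul, evD_sub, evD_C, ev_mul, ev_sub, ev_C]
        ring
      · refine Finset.sum_congr rfl fun i _ => ?_
        congr 1
        funext t
        rw [tr]
        ring
    · exact M.integrableOn_cell (by fun_prop) T
    · exact M.integrableOn_cell (by fun_prop) T
  simp only [numFlux, hW.trW_eq, hW.extW_eq, interfaceFlux_rest]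
  fin_cases c
  · simp [flux, topoSource, hW.apply_one, hW.apply_two]
  · simpa [flux, topoSource, hW.apply_one, hW.apply_two, hW.ev_zero] using key 0
  · simpa [flux, topoSource, hW.apply_one, hW.apply_two, hW.ev_zero] using key 1

@[simp] theorem VolumeRule.apply_zero (vr : VolumeRule M) (T : M.Elt) :
    vr.apply T (fun _ => 0) = 0 := by
  cases vr <;> simp [VolumeRule.apply]

theorem isAtRest_iff_eq {ηe : ℝ} {W : State M k} (hW : IsAtRest ηe W) (W' : State M k) :
    IsAtRest ηe W' ↔ W' = W := by
  constructor
  · intro h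
    funext c T
    fin_cases c
    · exact Subtype.ext ((h T).1.trans (hW T).1.symm)
    · exact (h T).2.1.trans (hW T).2.1.symm
    · exact (h T).2.2.trans (hW T).2.2.symm
  · rintro rfl
    exact hW

theorem IsAtRest.isEulerStep_iff (X : Nodes M k) {P : Params} {b : Plane → ℝ}
    (hP : LDGWellPosed M k P b) {vr : VolumeRule M} {fr : FaceRule} {ηe Δt : ℝ} (hΔ : 0 < Δt)
    {W : State M k} (hW : IsAtRest ηe W) (hex : ExactlyComputedAt P b vr fr W) (W' : State M k) :
    IsEulerStep X P b vr fr Δt W W' ↔ IsAtRest ηe W' := by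
  rw [isAtRest_iff_eq hW]
  have hstep : IsEulerStep X P b vr fr Δt W W' ↔ ∀ (T : M.Elt) (c : Fin 3) (φ : Pk k),
      M.volInt T (fun x => (ev (W' c T) x - ev (W c T) x) / Δt * ev φ x) = 0 := by
    simp only [IsEulerStep, hW.isDispersiveSource_iff X hP, exists_eq_left]
    refine forall_congr' fun T => forall_congr' fun c => forall_congr' fun φ => ?_
    obtain ⟨h1, h2, h3⟩ := hex T c φ
    rw [h1, h2, Finset.sum_congr rfl fun i _ => h3 i, ← hW.residual]
    -- Exactness is not needed for the dispersive integral: its integrand is identically zero, and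
    -- any cubature returns zero.
    have h0 : vr.apply T (fun x => ev ((0 : State M k) c T) x * ev φ x) = 0 := by simp
    rw [h0]
    constructor <;> intro h <;> linarith
  rw [hstep]
  constructor
  · intro h
    funext c T
    rw [← sub_eq_zero]
    refine Pk.eq_of_volInt (T := T) fun φ => ?_
    have h1 := h T c φ
    have e : ∀ x, (ev (W' c T) x - ev (W c T) x) / Δt * ev φ x
        = Δt⁻¹ * (ev ((W' c T - W c T : Pk k) : MvPolynomial (Fin 2) ℝ) x * ev φ x) := by
      intro x
      rw [Submodule.coe_sub, ev_sub]
      ring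
    simp only [e, M.volInt_const_mul] at h1
    rw [(mul_eq_zero.1 h1).resolve_left (inv_ne_zero hΔ.ne')]
    simp
  · rintro rfl T c φ
    simp

end AtRest

section Positivity

/-! ### Gauss and Gauss–Lobatto rules -/

/-- A nonnegative test polynomial that vanishes at all other nodes isolates one weight. -/
theorem weight_nonneg {n : ℕ} {x w : Fin n → ℝ} {p : Polynomial ℝ} {r : Fin n}
    (h : ∑ i, w i * p.eval (x i) = ∫ t in (0 : ℝ)..1, p.eval t)
    (hz : ∀ s, s ≠ r → p.eval (x s) = 0) (hr : 0 < p.eval (x r))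
    (hp : ∀ t ∈ Icc (0 : ℝ) 1, 0 ≤ p.eval t) : 0 ≤ w r := by
  rw [Finset.sum_eq_single r (fun s _ hs => by rw [hz s hs, mul_zero]) (by simp)] at h
  have := intervalIntegral.integral_nonneg zero_le_one (μ := volume) hp
  rw [← h] at this
  exact nonneg_of_mul_nonneg_left this hr

/-- The monic polynomial whose roots are the nodes with index in `A`. -/
noncomputable def nodal {n : ℕ} (x : Fin n → ℝ) (A : Finset (Fin n)) : Polynomial ℝ :=
  ∏ s ∈ A, (Polynomial.X - Polynomial.C (x s))

theorem natDegree_nodal {n : ℕ} (x : Fin n → ℝ) (A : Finset (Fin n)) :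
    (nodal x A).natDegree = A.card :=
  Polynomial.natDegree_finsetProd_X_sub_C_eq_card A x

theorem eval_nodal_eq_zero {n : ℕ} (x : Fin n → ℝ) {A : Finset (Fin n)} {s : Fin n} (hs : s ∈ A) :
    (nodal x A).eval (x s) = 0 := by
  rw [nodal, Polynomial.eval_prod]
  exact Finset.prod_eq_zero hs (by simp)

theorem eval_nodal_ne_zero {n : ℕ} {x : Fin n → ℝ} (hx : Function.Injective x)
    {A : Finset (Fin n)} {s : Fin n} (hs : s ∉ A) : (nodal x A).eval (x s) ≠ 0 := by
  rw [nodal, Polynomial.eval_prod, Finset.prod_ne_zero_iff]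
  intro r hr h
  simp only [Polynomial.eval_sub, Polynomial.eval_X, Polynomial.eval_C, sub_eq_zero] at h
  exact hs (hx h ▸ hr)

theorem IsGaussRule.weight_nonneg {n : ℕ} {x w : Fin n → ℝ} (h : IsGaussRule n x w) (r : Fin n) :
    0 ≤ w r := by
  have hn := r.2
  -- The squared nodal polynomial has degree `2n - 2`, within the exactness range `2n - 1`.
  refine GreenNaghdi.weight_nonneg (h.exact (nodal x (Finset.univ.erase r) ^ 2) ?_) ?_ ?_ ?_
  · rw [Polynomial.natDegree_pow, natDegree_nodal, Finset.card_erase_of_mem (Finset.mem_univ r),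
      Finset.card_univ, Fintype.card_fin]
    omega
  · intro s hs
    rw [Polynomial.eval_pow, eval_nodal_eq_zero x (by simp [hs])]
    simp
  · rw [Polynomial.eval_pow]
    have := eval_nodal_ne_zero h.strictMono.injective (A := Finset.univ.erase r) (s := r) (by simp)
    positivity
  · intro t _
    rw [Polynomial.eval_pow]
    positivity

/-- The indices of the interior nodes of a Gauss–Lobatto rule. -/
def innerIndices (m : ℕ) : Finset (Fin (m + 2)) := (Finset.univ.erase 0).erase (Fin.last (m + 1))

theorem card_innerIndices (m : ℕ) : (innerIndices m).card = m := by
  rw [innerIndices, Finset.card_erase_of_mem, Finset.card_erase_of_mem (Finset.mem_univ _)]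
  · simp
  · simp [Fin.ext_iff]

theorem mem_innerIndices {m : ℕ} {s : Fin (m + 2)} :
    s ∈ innerIndices m ↔ s ≠ Fin.last (m + 1) ∧ s ≠ 0 := by
  simp [innerIndices]

namespace IsGaussLobattoRule

variable {m : ℕ} {y ω : Fin (m + 2) → ℝ}

theorem first_eq (h : IsGaussLobattoRule (m + 2) y ω) : y 0 = 0 := h.first 0 rfl

theorem last_eq (h : IsGaussLobattoRule (m + 2) y ω) : y (Fin.last (m + 1)) = 1 :=
  h.last _ rfl

theorem natDegree_X_mul_le (q r : Polynomial ℝ) (hq : q.natDegree ≤ m) (hr : r.natDegree ≤ m) :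
    (Polynomial.X * (q * r)).natDegree + 3 ≤ 2 * (m + 2) := by
  have h1 := Polynomial.natDegree_mul_le (p := (Polynomial.X : Polynomial ℝ)) (q := q * r)
  have h2 := Polynomial.natDegree_mul_le (p := q) (q := r)
  rw [Polynomial.natDegree_X] at h1
  omega

theorem natDegree_one_sub_X : (1 - Polynomial.X : Polynomial ℝ).natDegree ≤ 1 :=
  (Polynomial.natDegree_sub_le _ _).trans (by simp)

theorem natDegree_one_sub_X_mul_le (q r : Polynomial ℝ) (hq : q.natDegree ≤ m)
    (hr : r.natDegree ≤ m) : ((1 - Polynomial.X) * (q * r)).natDegree + 3 ≤ 2 * (m + 2) := by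
  have h1 := Polynomial.natDegree_mul_le (p := (1 - Polynomial.X : Polynomial ℝ)) (q := q * r)
  have h2 := Polynomial.natDegree_mul_le (p := q) (q := r)
  have h3 := natDegree_one_sub_X
  omega

theorem sum_X_mul (h : IsGaussLobattoRule (m + 2) y ω) (r : Polynomial ℝ) :
    ∑ s, ω s * (Polynomial.X * (nodal y (innerIndices m) * r)).eval (y s)
      = ω (Fin.last _) * ((nodal y (innerIndices m)).eval 1 * r.eval 1) := by
  rw [Finset.sum_eq_single (Fin.last (m + 1))]
  · simp [h.last_eq]
  · intro s _ hs
    by_cases h0 : s = 0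
    · simp [h0, h.first_eq]
    · simp [eval_nodal_eq_zero y (mem_innerIndices.2 ⟨hs, h0⟩)]
  · simp

theorem sum_one_sub_X_mul (h : IsGaussLobattoRule (m + 2) y ω) (r : Polynomial ℝ) :
    ∑ s, ω s * ((1 - Polynomial.X) * (nodal y (innerIndices m) * r)).eval (y s)
      = ω 0 * ((nodal y (innerIndices m)).eval 0 * r.eval 0) := by
  rw [Finset.sum_eq_single 0]
  · simp [h.first_eq]
  · intro s _ hs
    by_cases h0 : s = Fin.last (m + 1)
    · simp [h0, h.last_eq]
    · simp [eval_nodal_eq_zero y (mem_innerIndices.2 ⟨h0, hs⟩)]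
  · simp

theorem eval_zero_ne (h : IsGaussLobattoRule (m + 2) y ω) :
    (nodal y (innerIndices m)).eval 0 ≠ 0 := by
  have := eval_nodal_ne_zero h.strictMono.injective (A := innerIndices m) (s := 0)
    (by simp [mem_innerIndices])
  rwa [h.first_eq] at this

theorem eval_one_ne (h : IsGaussLobattoRule (m + 2) y ω) :
    (nodal y (innerIndices m)).eval 1 ≠ 0 := by
  rw [← h.last_eq]
  exact eval_nodal_ne_zero h.strictMono.injective (by simp [mem_innerIndices])

/-- Symmetry of the nodes is not needed. With `q` the interior nodal polynomial, `X q(X) q(1 - X)`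
and its reflection `(1 - X) q(X) q(1 - X)` have the same integral. Their quadrature sums keep only
the last and only the first node, both with the factor `q(0) q(1) ≠ 0`. -/
theorem weight_last (h : IsGaussLobattoRule (m + 2) y ω) : ω (Fin.last _) = ω 0 := by
  set q := nodal y (innerIndices m) with hq
  have hdq : q.natDegree ≤ m := (natDegree_nodal _ _).trans (card_innerIndices m) |>.le
  have hdr : (q.comp (1 - Polynomial.X)).natDegree ≤ m := by
    rw [Polynomial.natDegree_comp]
    exact (Nat.mul_le_mul hdq natDegree_one_sub_X).trans (mul_one m).le
  have h1 := h.exact _ (natDegree_X_mul_le q (q.comp (1 - Polynomial.X)) hdq hdr)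
  have h2 := h.exact _ (natDegree_one_sub_X_mul_le q (q.comp (1 - Polynomial.X)) hdq hdr)
  rw [h.sum_X_mul] at h1
  rw [h.sum_one_sub_X_mul] at h2
  have hs := intervalIntegral.integral_comp_sub_left (a := 0) (b := 1)
    (fun t => (Polynomial.X * (q * q.comp (1 - Polynomial.X))).eval t) 1
  have hI : ∀ t : ℝ, (Polynomial.X * (q * q.comp (1 - Polynomial.X))).eval (1 - t)
      = ((1 - Polynomial.X) * (q * q.comp (1 - Polynomial.X))).eval t := by
    intro t
    simp only [Polynomial.eval_mul, Polynomial.eval_comp, Polynomial.eval_sub, Polynomial.eval_one,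
      Polynomial.eval_X, sub_sub_cancel]
    ring
  simp only [hI, sub_self, sub_zero] at hs
  rw [← hs, ← h2] at h1
  simp only [Polynomial.eval_comp, Polynomial.eval_sub, Polynomial.eval_one, Polynomial.eval_X,
    sub_self, sub_zero, ← hq] at h1
  have e0 := h.eval_zero_ne
  have e1 := h.eval_one_ne
  rw [mul_comm (Polynomial.eval 1 q)] at h1
  exact mul_right_cancel₀ (mul_ne_zero e0 e1) h1

/-- The test polynomial is `(1 - X) q²` for the first node, and `X (1 - X) q_r²` for an interior
node, where `q_r` omits the root `y r`. Both stay within the exactness degree `2m + 1`. -/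
theorem weight_nonneg (h : IsGaussLobattoRule (m + 2) y ω) (r : Fin (m + 2)) : 0 ≤ ω r := by
  have hdq : (nodal y (innerIndices m)).natDegree ≤ m :=
    (natDegree_nodal _ _).trans (card_innerIndices m) |>.le
  have hzero : 0 ≤ ω 0 := by
    have h2 := h.exact _ (natDegree_one_sub_X_mul_le _ _ hdq hdq)
    rw [h.sum_one_sub_X_mul] at h2
    have hp : 0 ≤ ∫ t in (0 : ℝ)..1, ((1 - Polynomial.X) *
        (nodal y (innerIndices m) * nodal y (innerIndices m))).eval t := by
      refine intervalIntegral.integral_nonneg zero_le_one fun t ht => ?_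
      simp only [Polynomial.eval_mul, Polynomial.eval_sub, Polynomial.eval_one, Polynomial.eval_X]
      exact mul_nonneg (by linarith [ht.2]) (mul_self_nonneg _)
    rw [← h2] at hp
    exact nonneg_of_mul_nonneg_left hp (mul_self_pos.2 h.eval_zero_ne)
  by_cases h0 : r = 0
  · rwa [h0]
  by_cases hl : r = Fin.last (m + 1)
  · rwa [hl, h.weight_last]
  have hr : r ∈ innerIndices m := mem_innerIndices.2 ⟨hl, h0⟩
  have hy0 : 0 < y r := by
    rw [← h.first_eq]
    exact h.strictMono (Fin.pos_iff_ne_zero.2 h0)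
  have hy1 : y r < 1 := by
    rw [← h.last_eq]
    exact h.strictMono (Fin.lt_last_iff_ne_last.2 hl)
  set q := nodal y ((innerIndices m).erase r)
  have hdq' : q.natDegree + 1 = m := by
    rw [natDegree_nodal, Finset.card_erase_of_mem hr, card_innerIndices]
    have := Finset.card_pos.2 ⟨r, hr⟩
    rw [card_innerIndices] at this
    omega
  refine GreenNaghdi.weight_nonneg (p := Polynomial.X * ((1 - Polynomial.X) * q * q))
    (h.exact _ (natDegree_X_mul_le _ _ ?_ ?_)) ?_ ?_ ?_
  · have h1 := Polynomial.natDegree_mul_le (p := (1 - Polynomial.X : Polynomial ℝ)) (q := q)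
    have h3 := natDegree_one_sub_X
    omega
  · omega
  · intro s hs
    by_cases hs0 : s = 0
    · simp [hs0, h.first_eq]
    by_cases hsl : s = Fin.last (m + 1)
    · simp [hsl, h.last_eq]
    · have : q.eval (y s) = 0 :=
        eval_nodal_eq_zero y (Finset.mem_erase.2 ⟨hs, mem_innerIndices.2 ⟨hsl, hs0⟩⟩)
      simp [this]
  · have : q.eval (y r) ≠ 0 := eval_nodal_ne_zero h.strictMono.injective (by simp)
    simp only [Polynomial.eval_mul, Polynomial.eval_sub, Polynomial.eval_one, Polynomial.eval_X]
    rw [mul_assoc]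
    exact mul_pos hy0 (mul_pos (by linarith) (mul_self_pos.2 this))
  · intro t ht
    simp only [Polynomial.eval_mul, Polynomial.eval_sub, Polynomial.eval_one, Polynomial.eval_X]
    rw [mul_assoc]
    exact mul_nonneg ht.1 (mul_nonneg (by linarith [ht.2]) (mul_self_nonneg _))

end IsGaussLobattoRule

/-! ### The Zhang–Shu decomposition of the mean value -/

variable {k : ℕ} {x w : Fin (k + 1) → ℝ} {y ω : Fin (lobattoCount k) → ℝ}

theorem IsGaussRule.sum_lineMap (h : IsGaussRule (k + 1) x w) (p : Pk k) (a c : Plane) :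
    ∑ r, w r * ev p (AffineMap.lineMap a c (x r))
      = ∫ t in (0 : ℝ)..1, ev p (AffineMap.lineMap a c t) := by
  obtain ⟨q, hq, he⟩ := exists_polynomial_lineMap p a c
  simp only [← he]
  exact h.exact q (by omega)

/-- The Jacobian factor raises the degree to `k + 1`, still at most `2k + 1`. -/
theorem IsGaussRule.sum_one_sub_mul_lineMap (h : IsGaussRule (k + 1) x w) (p : Pk k)
    (a c : Plane) :
    ∑ r, w r * ((1 - x r) * ev p (AffineMap.lineMap a c (x r)))
      = ∫ t in (0 : ℝ)..1, (1 - t) * ev p (AffineMap.lineMap a c t) := by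
  obtain ⟨q, hq, he⟩ := exists_polynomial_lineMap p a c
  have hd : ((1 - Polynomial.X) * q).natDegree + 1 ≤ 2 * (k + 1) := by
    have h1 := Polynomial.natDegree_mul_le (p := (1 - Polynomial.X : Polynomial ℝ)) (q := q)
    have h3 := IsGaussLobattoRule.natDegree_one_sub_X
    omega
  simpa [he] using h.exact _ hd

theorem IsGaussLobattoRule.sum_lineMap (h : IsGaussLobattoRule (lobattoCount k) y ω) (p : Pk k)
    (a c : Plane) :
    ∑ s, ω s * ev p (AffineMap.lineMap a c (y s))
      = ∫ t in (0 : ℝ)..1, ev p (AffineMap.lineMap a c t) := by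
  obtain ⟨q, hq, he⟩ := exists_polynomial_lineMap p a c
  simp only [← he]
  exact h.exact q (by simp only [lobattoCount]; omega)

theorem volInt_eq_sum_duffy {M : TriMesh} (hx : IsGaussRule (k + 1) x w)
    (hy : IsGaussLobattoRule (lobattoCount k) y ω) (T : M.Elt) (i : Fin 3) (p : Pk k) :
    M.volInt T (ev p) = |orient (M.vert T)| *
      ∑ s, ω s * ∑ r, w r * ((1 - x r) * ev p (duffy (M.vert T) i (y s) (x r))) := by
  rw [TriMesh.volInt, TriMesh.cell, setIntegral_triangle (M.nondegenerate T) i (continuous_ev _)]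
  congr 1
  have hu : ∀ v, ∫ u in (0 : ℝ)..1, ev p (duffy (M.vert T) i u v)
      = ∑ s, ω s * ev p (duffy (M.vert T) i (y s) v) := by
    intro v
    have e : ∀ u, duffy (M.vert T) i u v = AffineMap.lineMap
        (duffy (M.vert T) i 0 v) (duffy (M.vert T) i 1 v) u := by
      intro u
      simp only [duffy, AffineMap.lineMap_apply_module]
      module
    exact (intervalIntegral.integral_congr fun u _ => congrArg (ev p) (e u)).trans
      ((hy.sum_lineMap p _ _).symm.trans (Finset.sum_congr rfl fun s _ => by rw [← e]))
  have hc : ∀ u, Continuous fun v => (1 - v) * ev p (duffy (M.vert T) i u v) := by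
    intro u; unfold duffy; fun_prop
  simp only [hu, Finset.mul_sum (s := (Finset.univ : Finset (Fin (lobattoCount k)))),
    mul_left_comm (1 - _) (ω _)]
  rw [intervalIntegral.integral_finsetSum
    fun s _ => ((hc (y s)).const_mul (ω s)).intervalIntegrable _ _]
  refine Finset.sum_congr rfl fun s _ => ?_
  rw [intervalIntegral.integral_const_mul]
  simp only [duffy_eq_lineMap]
  rw [hx.sum_one_sub_mul_lineMap]

theorem duffy_zero (M : TriMesh) (T : M.Elt) (i : Fin 3) (v : ℝ) :
    duffy (M.vert T) i 0 v = M.pt T (i + 1) v := by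
  rw [duffy_eq_lineMap, AffineMap.lineMap_apply_zero, TriMesh.pt]
  fin_cases i <;> rfl

theorem duffy_one (M : TriMesh) (T : M.Elt) (i : Fin 3) (v : ℝ) :
    duffy (M.vert T) i 1 v = M.pt T (i + 2) (1 - v) := by
  rw [duffy_eq_lineMap, AffineMap.lineMap_apply_one, TriMesh.pt, AffineMap.lineMap_apply_one_sub]
  fin_cases i <;> rfl

/-- All terms of the tensor sum are nonnegative, so only the layers `u = 0` and `u = 1` are kept.
The second one runs along its face backwards, which changes the weight `1 - t` into `t`. -/
theorem faces_le_volInt_of_duffy {M : TriMesh} (hx : IsGaussRule (k + 1) x w)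
    (hy : IsGaussLobattoRule (lobattoCount k) y ω) (T : M.Elt) {p : Pk k}
    (hp : ∀ z ∈ zhangShuNodes M k y x T, 0 ≤ ev p z) (i : Fin 3) :
    |orient (M.vert T)| * (ω 0 * ((∫ t in (0 : ℝ)..1, (1 - t) * ev p (M.pt T (i + 1) t))
      + ∫ t in (0 : ℝ)..1, t * ev p (M.pt T (i + 2) t))) ≤ M.volInt T (ev p) := by
  rw [volInt_eq_sum_duffy hx hy T i p]
  refine mul_le_mul_of_nonneg_left ?_ (abs_nonneg _)
  have hnn : ∀ s, 0 ≤ ω s * ∑ r, w r * ((1 - x r) * ev p (duffy (M.vert T) i (y s) (x r))) :=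
    fun s => mul_nonneg (hy.weight_nonneg s) (Finset.sum_nonneg fun r _ =>
      mul_nonneg (hx.weight_nonneg r) (mul_nonneg (by linarith [(hx.mem r).2])
        (hp _ ⟨i, s, r, rfl⟩)))
  have hsub := Finset.sum_le_sum_of_subset_of_nonneg
    (Finset.subset_univ ({0, Fin.last (k / 2 + 1)} : Finset (Fin (lobattoCount k))))
    fun s _ _ => hnn s
  refine le_trans (le_of_eq ?_) hsub
  rw [Finset.sum_pair (by simp [Fin.ext_iff]), hy.weight_last, hy.first_eq, hy.last_eq, ← mul_add]
  congr 2
  · simp only [duffy_zero]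
    exact (hx.sum_one_sub_mul_lineMap p _ _).symm
  · have e : ∀ v, duffy (M.vert T) i 1 v = AffineMap.lineMap
        (M.vert T (i + 1)) (M.vert T i) v := by
      intro v
      rw [duffy_eq_lineMap, AffineMap.lineMap_apply_one]
    simp only [e]
    rw [hx.sum_one_sub_mul_lineMap]
    simp only [← e, duffy_one]
    have := intervalIntegral.integral_comp_sub_left (a := 0) (b := 1)
      (fun t => t * ev p (M.pt T (i + 2) t)) 1
    simpa using this.symm

/-- Sum of the three one-map estimates: every face occurs once with weight `1 - t` and once with
`t`. Since `|orient| = 2|T|`, division by three gives `2/3`. -/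
theorem faces_le_volInt {M : TriMesh} (hx : IsGaussRule (k + 1) x w)
    (hy : IsGaussLobattoRule (lobattoCount k) y ω) (T : M.Elt) {p : Pk k}
    (hp : ∀ z ∈ zhangShuNodes M k y x T, 0 ≤ ev p z) :
    M.area T * (2 / 3 * ω 0 * ∑ j, ∑ r, w r * ev p (M.pt T j (x r))) ≤ M.volInt T (ev p) := by
  have hsum : ∀ j, ∑ r, w r * ev p (M.pt T j (x r))
      = (∫ t in (0 : ℝ)..1, (1 - t) * ev p (M.pt T j t))
        + ∫ t in (0 : ℝ)..1, t * ev p (M.pt T j t) := by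
    intro j
    have hc := M.continuous_pt T j
    rw [← intervalIntegral.integral_add]
    · refine (hx.sum_lineMap p _ _).trans (intervalIntegral.integral_congr fun t _ => ?_)
      simp only [TriMesh.pt]
      ring
    · exact Continuous.intervalIntegrable (by fun_prop) _ _
    · exact Continuous.intervalIntegrable (by fun_prop) _ _
  have h0 := faces_le_volInt_of_duffy hx hy T hp 0
  have h1 := faces_le_volInt_of_duffy hx hy T hp 1
  have h2 := faces_le_volInt_of_duffy hx hy T hp 2
  simp only [hsum, Fin.sum_univ_three, M.area_eq]
  simp only [zero_add, show (1 : Fin 3) + 1 = 2 from rfl, show (1 : Fin 3) + 2 = 0 from rfl,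
    show (2 : Fin 3) + 1 = 0 from rfl, show (2 : Fin 3) + 2 = 1 from rfl] at h0 h1 h2
  linarith

theorem nonneg_at_face_nodes {M : TriMesh} (hy : IsGaussLobattoRule (lobattoCount k) y ω)
    (T : M.Elt) {p : Pk k} (hp : ∀ z ∈ zhangShuNodes M k y x T, 0 ≤ ev p z) (j : Fin 3)
    (r : Fin (k + 1)) : 0 ≤ ev p (M.pt T j (x r)) := by
  have hj : j + 2 + 1 = j := by fin_cases j <;> rfl
  -- The map of index `j + 2` sends the side `u = 0` to face `j + 3 = j`.
  have h := hp _ ⟨j + 2, 0, r, rfl⟩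
  rw [hy.first_eq] at h
  rw [← hj, ← duffy_zero]
  exact h

/-! ### Positivity -/

/-- The common reconstructed bottom cancels in the jump, so the mass flux is half of `ȟ⁻ (u⁻·n + a)
- ȟ⁺ (a - u⁺·n)`. The second product is nonnegative, the first is at most `2 a ȟ⁻`, and `ȟ⁻ ≤ h⁻`.
The sign of the exterior depth is irrelevant, since `ȟ⁺ ≥ 0` by truncation. -/
theorem interfaceFlux_zero_le {P : Params} {a bm bp : ℝ} {Wm Wp : Fin 3 → ℝ} {n : Plane}
    (hm : 0 ≤ Wm 0 - bm)
    (hum : |Wm 1 / (Wm 0 - bm) * n 0 + Wm 2 / (Wm 0 - bm) * n 1| ≤ a)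
    (hup : |Wp 1 / (Wp 0 - bp) * n 0 + Wp 2 / (Wp 0 - bp) * n 1| ≤ a) :
    interfaceFlux P a Wm Wp bm bp n 0 ≤ a * (Wm 0 - bm) := by
  have e : interfaceFlux P a Wm Wp bm bp n 0 =
      1 / 2 * (hCheck (Wm 0) (max bm bp) * (Wm 1 / (Wm 0 - bm) * n 0 + Wm 2 / (Wm 0 - bm) * n 1 + a)
        - hCheck (Wp 0) (max bm bp) *
          (a - (Wp 1 / (Wp 0 - bp) * n 0 + Wp 2 / (Wp 0 - bp) * n 1))) := by
    simp [interfaceFlux, laxFriedrichs, wCheck, flux]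
    ring
  have ha : 0 ≤ a := (abs_nonneg _).trans hum
  have hm0 : 0 ≤ hCheck (Wm 0) (max bm bp) := le_max_left _ _
  have hp0 : 0 ≤ hCheck (Wp 0) (max bm bp) := le_max_left _ _
  have hle : hCheck (Wm 0) (max bm bp) ≤ Wm 0 - bm :=
    max_le hm (by linarith [le_max_left bm bp])
  have h1 := mul_le_mul_of_nonneg_left (le_of_abs_le hum) hm0
  have h2 := mul_nonneg hp0 (sub_nonneg.2 (le_of_abs_le hup))
  have h3 := mul_le_mul_of_nonneg_left hle ha
  rw [e]
  linarith

variable {M : TriMesh}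

/-- Boundedness is essential: the supremum of an unbounded set would take the default value `0`. -/
theorem speed_le_maxSpeed {P : Params} {bh : Field M k} {W : State M k}
    (hb : ∀ T, BddAbove (speedSet P bh W T)) (T : M.Elt) (i : Fin 3) {t : ℝ}
    (ht : t ∈ Icc (0 : ℝ) 1) :
    |tr (W 1) T i t / (tr (W 0) T i t - tr bh T i t) * M.normal T i 0
      + tr (W 2) T i t / (tr (W 0) T i t - tr bh T i t) * M.normal T i 1| ≤ maxSpeed P bh W :=
  (le_add_of_nonneg_right (Real.sqrt_nonneg _)).trans
    ((le_csSup (hb T) ⟨i, t, ht, rfl⟩).trans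
      (le_ciSup (f := lam P bh W) (Set.finite_range _).bddAbove T))

theorem TriMesh.exists_pt_eq_of_glue {T T' : M.Elt} {i j : Fin 3} (hg : M.glue T i = some (T', j))
    {t : ℝ} (ht : t ∈ Icc (0 : ℝ) 1) :
    ∃ t' ∈ Icc (0 : ℝ) 1, M.pt T i t + triShift (M.vert T) (M.vert T') i j = M.pt T' j t' := by
  have h : M.pt T i t + triShift (M.vert T) (M.vert T') i j ∈ triFace (M.vert T') j := by
    rw [← M.glue_face T T' i j hg]
    refine mem_image_of_mem _ ?_
    rw [triFace, segment_eq_image_lineMap]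
    exact mem_image_of_mem _ ht
  rw [triFace, segment_eq_image_lineMap] at h
  obtain ⟨t', ht', he⟩ := h
  exact ⟨t', ht', he.symm⟩

/-- At a wall the mirror image only reverses the normal velocity, because the normal has length one.
Elsewhere the exterior trace is an interior trace of the neighbour at a point of its own face, with
opposite normal. -/
theorem exterior_speed_le_maxSpeed {P : Params} {bh : Field M k} {W : State M k}
    (hb : ∀ T, BddAbove (speedSet P bh W T)) (T : M.Elt) (i : Fin 3) {t : ℝ}
    (ht : t ∈ Icc (0 : ℝ) 1) :
    |extW W T i t 1 / (extW W T i t 0 - ext bh T i t) * M.normal T i 0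
      + extW W T i t 2 / (extW W T i t 0 - ext bh T i t) * M.normal T i 1| ≤ maxSpeed P bh W := by
  rcases hg : M.glue T i with _ | ⟨T', j⟩
  · refine le_trans (le_of_eq ?_) (speed_le_maxSpeed hb T i ht)
    rw [← abs_neg]
    congr 1
    have hn := M.normal_sq T i
    simp [extW, extV, ext, hg, reflMat]
    linear_combination (2 * (tr (W 1) T i t * M.normal T i 0 + tr (W 2) T i t * M.normal T i 1)
      / (tr (W 0) T i t - tr bh T i t)) * hn
  · obtain ⟨t', ht', he⟩ := TriMesh.exists_pt_eq_of_glue hg ht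
    refine le_trans (le_of_eq ?_) (speed_le_maxSpeed hb T' j ht')
    have hn : ∀ l, M.normal T' j l = -M.normal T i l := by
      intro l
      rw [TriMesh.normal, M.glue_normal T T' i j hg]
      rfl
    rw [← abs_neg, hn, hn]
    congr 1
    simp [extW, extV, ext, hg, he, tr]
    ring

theorem numFlux_zero_le {P : Params} {bh : Field M k} {W : State M k}
    (hb : ∀ T, BddAbove (speedSet P bh W T)) (T : M.Elt) (i : Fin 3) {t : ℝ}
    (ht : t ∈ Icc (0 : ℝ) 1) (hh : 0 ≤ ev ((W 0 - bh) T) (M.pt T i t)) :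
    numFlux P bh W T i t 0 ≤ maxSpeed P bh W * ev ((W 0 - bh) T) (M.pt T i t) := by
  have e : ev ((W 0 - bh) T) (M.pt T i t) = trW W T i t 0 - tr bh T i t := by
    rw [Pi.sub_apply, Submodule.coe_sub, ev_sub]
    rfl
  rw [e] at hh ⊢
  exact interfaceFlux_zero_le hh (speed_le_maxSpeed hb T i ht)
    (exterior_speed_le_maxSpeed hb T i ht)

/-- Mass balance from `φ = 1`: the flux, dispersive and topography integrands vanish identically, so
the volume rule does not matter. -/
theorem volInt_depth_eulerStep {X : Nodes M k} {P : Params} {b : Plane → ℝ} {vr : VolumeRule M}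
    {fr : FaceRule} {Δt : ℝ} (hΔ : 0 < Δt) {W W' : State M k}
    (h : IsEulerStep X P b vr fr Δt W W') (T : M.Elt) :
    M.volInt T (ev ((W' 0 - l2proj M k b) T)) = M.volInt T (ev ((W 0 - l2proj M k b) T))
      - Δt * ∑ i, fr.apply M T i (fun t => numFlux P (l2proj M k b) W T i t 0) := by
  obtain ⟨D, ⟨_, _, _, _, _, _, hD, _⟩, hstep⟩ := h
  have h1 := hstep T 0 ⟨1, by simp [MvPolynomial.mem_restrictTotalDegree]⟩
  simp only [hD, evD_one, ev_one, topoSource] at h1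
  simp at h1
  have e : ∀ x, ev ((W' 0 - l2proj M k b) T) x = ev ((W 0 - l2proj M k b) T) x
      + Δt * ((ev (W' 0 T) x - ev (W 0 T) x) / Δt) := by
    intro x
    simp only [Pi.sub_apply, Submodule.coe_sub, ev_sub]
    field_simp
    ring
  have e2 : M.volInt T (ev ((W' 0 - l2proj M k b) T)) = M.volInt T (ev ((W 0 - l2proj M k b) T))
      + Δt * M.volInt T (fun x => (ev (W' 0 T) x - ev (W 0 T) x) / Δt) := by
    rw [← M.volInt_const_mul, TriMesh.volInt, TriMesh.volInt, TriMesh.volInt, ← integral_add]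
    · exact integral_congr_ae (Filter.Eventually.of_forall e)
    · exact M.integrableOn_cell (by fun_prop) T
    · exact M.integrableOn_cell (by fun_prop) T
  rw [e2, eq_neg_of_add_eq_zero_left h1]
  simp [Fin.sum_univ_three]
  ring

theorem mean_depth_nonneg {X : Nodes M k} {P : Params} {b : Plane → ℝ} {vr : VolumeRule M}
    (hx : IsGaussRule (k + 1) x w) (hy : IsGaussLobattoRule (lobattoCount k) y ω) {Δt : ℝ}
    (hΔ : 0 < Δt) {W W' : State M k}
    (hstep : IsEulerStep X P b vr (FaceRule.quadrature (k + 1) x w) Δt W W')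
    (hb : ∀ T, BddAbove (speedSet P (l2proj M k b) W T)) (T : M.Elt)
    (hpos : ∀ z ∈ zhangShuNodes M k y x T, 0 ≤ ev ((W 0 - l2proj M k b) T) z)
    (hcfl : maxSpeed P (l2proj M k b) W * (M.perimeter T / M.area T) * Δt ≤ 2 / 3 * ω 0) :
    0 ≤ mean (W' 0 - l2proj M k b) T := by
  have hA := M.area_pos T
  refine mul_nonneg (inv_nonneg.2 hA.le) ?_
  rw [volInt_depth_eulerStep hΔ hstep, sub_nonneg]
  refine le_trans ?_ (faces_le_volInt hx hy T hpos)
  set a := maxSpeed P (l2proj M k b) W with ha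
  set H : Fin 3 → ℝ := fun j => ∑ r, w r * ev ((W 0 - l2proj M k b) T) (M.pt T j (x r)) with hH
  have ha0 : 0 ≤ a := (abs_nonneg _).trans (speed_le_maxSpeed hb T 0 ⟨le_rfl, zero_le_one⟩)
  have hH0 : ∀ j, 0 ≤ H j := fun j => Finset.sum_nonneg fun r _ =>
    mul_nonneg (hx.weight_nonneg r) (nonneg_at_face_nodes hy T hpos j r)
  have hface : ∀ j, (FaceRule.quadrature (k + 1) x w).apply M T j
      (fun t => numFlux P (l2proj M k b) W T j t 0) ≤ M.perimeter T * (a * H j) := by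
    intro j
    -- Bounding each face length by the whole perimeter gives one constant for all three faces, the
    -- one in the CFL condition.
    have hlen : M.len T j ≤ M.perimeter T :=
      Finset.single_le_sum (f := M.len T) (fun i _ => (M.len_pos T i).le) (Finset.mem_univ j)
    have hsum : ∑ r, w r * numFlux P (l2proj M k b) W T j (x r) 0 ≤ a * H j := by
      rw [hH, Finset.mul_sum]
      refine Finset.sum_le_sum fun r _ => ?_
      rw [mul_left_comm]
      exact mul_le_mul_of_nonneg_left
        (numFlux_zero_le hb T j (hx.mem r) (nonneg_at_face_nodes hy T hpos j r))
        (hx.weight_nonneg r)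
    exact (mul_le_mul_of_nonneg_left hsum (M.len_pos T j).le).trans
      (mul_le_mul_of_nonneg_right hlen (mul_nonneg ha0 (hH0 j)))
  have hS : 0 ≤ ∑ j, H j := Finset.sum_nonneg fun j _ => hH0 j
  have hcfl' : Δt * (M.perimeter T * a) ≤ M.area T * (2 / 3 * ω 0) := by
    have := mul_le_mul_of_nonneg_left hcfl hA.le
    refine le_trans (le_of_eq ?_) this
    field_simp
  calc Δt * ∑ j, (FaceRule.quadrature (k + 1) x w).apply M T j
        (fun t => numFlux P (l2proj M k b) W T j t 0)
      ≤ Δt * ∑ j, M.perimeter T * (a * H j) :=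
        mul_le_mul_of_nonneg_left (Finset.sum_le_sum fun j _ => hface j) hΔ.le
    _ = Δt * (M.perimeter T * a) * ∑ j, H j := by
        rw [← Finset.mul_sum, ← Finset.mul_sum]
        ring
    _ ≤ M.area T * (2 / 3 * ω 0) * ∑ j, H j := mul_le_mul_of_nonneg_right hcfl' hS
    _ = M.area T * (2 / 3 * ω 0 * ∑ j, H j) := by ring

end Positivity

end GreenNaghdi

open GreenNaghdi in
theorem mainTheorem1 (M : TriMesh) (k : ℕ) (P : Params) (b : Plane → ℝ)
    (hb : ∃ L, LipschitzOnWith L b (closure M.Ω)) (X : Nodes M k) (vr : VolumeRule M) :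
    -- (1) well-balancing
    (∀ (fr : FaceRule) (ηe Δt : ℝ) (W : State M k), 0 < Δt → IsAtRest ηe W →
      LDGWellPosed M k P b → ExactlyComputedAt P b vr fr W →
        (∀ D : State M k, IsDispersiveSource X P b W D ↔ D = 0) ∧
        (∀ W' : State M k, IsEulerStep X P b vr fr Δt W W' ↔ IsAtRest ηe W')) ∧
    -- (2) positivity
    (∀ (x w : Fin (k + 1) → ℝ) (y ω : Fin (lobattoCount k) → ℝ),
      IsGaussRule (k + 1) x w → IsGaussLobattoRule (lobattoCount k) y ω →
      ∀ (Δt : ℝ) (W W' : State M k), 0 < Δt →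
        IsEulerStep X P b vr (FaceRule.quadrature (k + 1) x w) Δt W W' →
        (∀ T, BddAbove (speedSet P (l2proj M k b) W T)) →
        (∀ T, 0 ≤ mean (W 0 - l2proj M k b) T) →
        (∀ T, ∀ z ∈ zhangShuNodes M k y x T, 0 ≤ ev ((W 0 - l2proj M k b) T) z) →
        (∀ T, maxSpeed P (l2proj M k b) W * (M.perimeter T / M.area T) * Δt ≤ 2 / 3 * ω 0) →
        ∀ T, 0 ≤ mean (W' 0 - l2proj M k b) T) := by
  refine ⟨?_, ?_⟩
  · intro fr ηe Δt W hΔ hW hP hex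
    exact ⟨hW.isDispersiveSource_iff X hP, hW.isEulerStep_iff X hP hΔ hex⟩
  · intro x w y ω hx hy Δt W W' hΔ hstep hb _ hpos hcfl T
    exact mean_depth_nonneg hx hy hΔ hstep hb T (hpos T) (hcfl T)
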